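/- Consider a server visit to one queue $Q_q$ of a polling system with queues $Q_1,\dots,Q_M$ under the $k$-limited discipline: the server leaves as soon as $k$ jobs have been served in this visit or $Q_q$ is empty (at once, if it finds $Q_q$ empty). Jobs arrive at $Q_m$ according to a Poisson process with rate $\lambda_m>0$, the service requirements at $Q_q$ are i.i.d. exponential with mean $b>0$, and the arrival processes (counted from the beginning of the visit), the service requirements and the vector $N^b=(N^b_1,\dots,N^b_M)$ of queue lengths at the beginning of the visit are independent; the law of $N^b$ is arbitrary. Let $N^e=N^{e,k}$ be the vector of queue lengths at the end of the visit. Let $z\in\mathbb C^M$ with $|z_m|\le 1$ for all $m$, write $z^n=\prod_m z_m^{n_m}$ (with $0^0=1$), $\sigma=\sum_{m\ne q}\lambda_m(1-z_m)$ and $x=(\lambda_q+\sigma+1/b)/\lambda_q$. Below, $i\in\mathbb N^M$ ranges over the vectors with $P(N^b=i)>0$, and all the expectations of $z^{N^e}$ are those of integrable random variables. (1) General $k\ge 2$. Let $c^n(i,j)$, $n,i,j\ge1$, be the number of lattice paths $i=l_0,l_1,\dots,l_n=j$ in the positive integers with $l_{t+1}\ge l_t-1$, that is, $c^1(i,j)=1$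 if $j\ge i-1$ and $0$ otherwise, and $c^n(i,j)=\sum_{l=1}^{j+1}c^{n-1}(i,l)$ for $n\ge 2$. The polynomial $\lambda_q y^2-(\lambda_q+1/b+\sigma)y+1/b$ has a root with $|y|\le1$, which is the only one if $\lambda_q b<1$. For every such root $y$ and every $i$ with $i_q\ge1$, $$E[z^{N^e}\mid N^b=i]=-\frac1b\Big(\prod_{m\ne q}z_m^{i_m}\Big)S,$$ $$S=\frac{b\,c^{k-1}(i_q,1)}{(\lambda_qb)^k}x^{-2k+i_q}-b\,y^{i_q}-\frac{b\,x^{-2k+i_q+1}}{(\lambda_qb)^k(x-z_q)}\sum_{j=1}^\infty c^{k-1}(i_q,j)\Big(\frac{z_q}{x}\Big)^{j-1}+\frac{b\,x^{-2k+i_q}}{(\lambda_qb)^k}\sum_{j=1}^\infty c^{k}(i_q,j)\Big(\frac{y}{x}\Big)^{j},$$ where both series converge absolutely. (2) $k=1$. One has $$E[z^{N^e}\mid N^b=i]=\frac{\prod_{m\ne q}z_m^{i_m}}{\lambda_qbx}\Big(\frac{z_q}{x-z_q}+1\Big)\ \text{ if } i_q=1,\qquad E[z^{N^e}\mid N^b=i]=\Big(\prod_{m\ne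 q}z_m^{i_m}\Big)\frac{z_q^{i_q-1}}{\lambda_qb(x-z_q)}\ \text{ if } i_q\ge2,$$ and, if $z_q\ne0$, $$E[z^{N^e}]=\frac{\frac1b z_q^{-1}}{\frac1b+\lambda_q(1-z_q)+\sigma}\,E[z^{N^b}]+\Big(1-\frac{\frac1b z_q^{-1}}{\frac1b+\lambda_q(1-z_q)+\sigma}\Big)E[z^{N^b}]\Big|_{z_q=0}.$$ (3) $k=2$. One has $$E[z^{N^e}\mid N^b=i]=\frac{\prod_{m\ne q}z_m^{i_m}}{\lambda_qbx}\Big(\frac{1}{\lambda_qb(x-z_q)^2}+1\Big)\ \text{ if } i_q=1,\qquad E[z^{N^e}\mid N^b=i]=\Big(\prod_{m\ne q}z_m^{i_m}\Big)\frac{z_q^{i_q-2}}{\lambda_q^2b^2(x-z_q)^2}\ \text{ if } i_q\ge2,$$ and, if $z_q\ne0$, $$E[z^{N^e}]=\frac{z_q^{-2}}{\lambda_q^2b^2(x-z_q)^2}E[z^{N^b}]+\Big(1-\frac{z_q^{-2}}{\lambda_q^2b^2(x-z_q)^2}\Big)E[z^{N^b}]\Big|_{z_q=0}+\Big(\frac{z_q^{-1}}{\lambda_qbx}-\frac{z_q^{-2}}{\lambda_q^2b^2x(x-z_q)}\Big)E\big[\mathbf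 1_{\{N^b_q=1\}}z^{N^b}\big].$$ -/

import Mathlib

open MeasureTheory ProbabilityTheory
open scoped NNReal

namespace Polling

/-- `A` is a Poisson process of rate `lam` on the probability space `(Ω, P)`: a counting process
that starts in `0`, has nondecreasing right-continuous paths, independent increments, and
increments over `(s, t]` with the Poisson distribution of mean `lam * (t - s)`. -/
structure IsPoissonProcess {Ω : Type*} [MeasurableSpace Ω] (P : Measure Ω) (lam : ℝ)
    (A : ℝ≥0 → Ω → ℕ) : Prop where
  measurable : ∀ t, Measurable (A t)
  zero : ∀ ω, A 0 ω = 0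
  mono : ∀ ω, Monotone fun t => A t ω
  rightCont : ∀ ω t, ContinuousWithinAt (fun s => A s ω) (Set.Ici t) t
  indep : HasIndepIncrements A P
  law : ∀ s t : ℝ≥0, s ≤ t →
    HasLaw (fun ω => A t ω - A s ω) (poissonMeasure (lam * ((t : ℝ) - s)).toNNReal) P

/-- The stochastic primitives of a server visit to a queue of a polling system with `M` queues.
Time `0` is the instant at which the visit begins. `Nb` is the vector of the numbers of jobs in
the `M` queues at that instant, `A m t` is the number of jobs that arrive at queue `m` during
`(0, t]`, and `S n` is the service requirement of the `(n+1)`-st job served in the visit.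
Arrivals at queue `m` form a Poisson process of rate `lam m`, service requirements are i.i.d.
exponential with mean `b`, and all these objects are independent. The law of `Nb` is arbitrary. -/
structure IsVisitModel {Ω : Type*} [MeasurableSpace Ω] (P : Measure Ω) {M : ℕ}
    (lam : Fin M → ℝ) (b : ℝ) (Nb : Ω → Fin M → ℕ) (A : Fin M → ℝ≥0 → Ω → ℕ)
    (S : ℕ → Ω → ℝ≥0) : Prop where
  measurable_begin : Measurable Nb
  poisson : ∀ m, IsPoissonProcess P (lam m) (A m)
  measurable_service : ∀ n, Measurable (S n)
  service_law : ∀ n, HasLaw (fun ω => (S n ω : ℝ)) (expMeasure (1 / b)) P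
  service_indep : iIndepFun S P
  arrival_indep : iIndepFun (fun (m : Fin M) (ω : Ω) (t : ℝ≥0) => A m t ω) P
  service_arrival_indep : IndepFun (fun (ω : Ω) (n : ℕ) => S n ω)
    (fun (ω : Ω) (m : Fin M) (t : ℝ≥0) => A m t ω) P
  begin_indep : IndepFun Nb
    (fun ω : Ω => ((fun n : ℕ => S n ω), fun (m : Fin M) (t : ℝ≥0) => A m t ω)) P

/-- The instant, measured from the beginning of the visit, at which the `n`-th service of the
visit is completed. -/
noncomputable def departureTime {Ω : Type*} (S : ℕ → Ω → ℝ≥0) (n : ℕ) (ω : Ω) : ℝ≥0 :=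
  ∑ r ∈ Finset.range n, S r ω

/-- The numbers of jobs in the queues just after the `n`-th departure of a visit to queue `q`
(for `n = 0`, at the beginning of the visit), as long as the server has not left before. -/
noncomputable def queuesAfter {Ω : Type*} {M : ℕ} (Nb : Ω → Fin M → ℕ)
    (A : Fin M → ℝ≥0 → Ω → ℕ) (S : ℕ → Ω → ℝ≥0) (q : Fin M) (n : ℕ) (ω : Ω) : Fin M → ℕ :=
  fun m => Nb ω m + A m (departureTime S n ω) ω - (if m = q then n else 0)

/-- The number of jobs served during a visit to queue `q` under the `k`-limited discipline: the
server leaves as soon as `k` jobs have been served or queue `q` is empty. -/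
noncomputable def servedJobs {Ω : Type*} {M : ℕ} (Nb : Ω → Fin M → ℕ)
    (A : Fin M → ℝ≥0 → Ω → ℕ) (S : ℕ → Ω → ℝ≥0) (q : Fin M) (k : ℕ) (ω : Ω) : ℕ :=
  sInf {n : ℕ | n = k ∨ queuesAfter Nb A S q n ω q = 0}

/-- `N^e`: the numbers of jobs in the queues at the end of a visit to queue `q` under the
`k`-limited discipline. -/
noncomputable def endState {Ω : Type*} {M : ℕ} (Nb : Ω → Fin M → ℕ)
    (A : Fin M → ℝ≥0 → Ω → ℕ) (S : ℕ → Ω → ℝ≥0) (q : Fin M) (k : ℕ) (ω : Ω) : Fin M → ℕ :=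
  queuesAfter Nb A S q (servedJobs Nb A S q k ω) ω

/-- `z^n = z_1^{n_1} ⋯ z_M^{n_M}`. -/
noncomputable def monom {M : ℕ} (z : Fin M → ℂ) (n : Fin M → ℕ) : ℂ := ∏ m, z m ^ n m

/-- The joint probability generating function `E[z^N]` of `N` under `P`. -/
noncomputable def pgf {Ω : Type*} [MeasurableSpace Ω] (P : Measure Ω) {M : ℕ}
    (N : Ω → Fin M → ℕ) (z : Fin M → ℂ) : ℂ := ∫ ω, monom z (N ω) ∂P

/-- The conditional probability generating function `E[z^N | Nb = i]`. -/
noncomputable def condPgf {Ω : Type*} [MeasurableSpace Ω] (P : Measure Ω) {M : ℕ}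
    (N Nb : Ω → Fin M → ℕ) (i : Fin M → ℕ) (z : Fin M → ℂ) : ℂ := pgf (P[|Nb ⁻¹' {i}]) N z

/-- `∑_{m ≠ q} lam_m (1 - z_m)`. -/
noncomputable def otherRate {M : ℕ} (lam : Fin M → ℝ) (q : Fin M) (z : Fin M → ℂ) : ℂ :=
  ∑ m ∈ Finset.univ.erase q, (lam m : ℂ) * (1 - z m)

/-- `x = (lam_q + ∑_{m ≠ q} lam_m (1 - z_m) + 1 / b) / lam_q`. -/
noncomputable def xParam {M : ℕ} (lam : Fin M → ℝ) (b : ℝ) (q : Fin M) (z : Fin M → ℂ) : ℂ :=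
  ((lam q : ℂ) + otherRate lam q z + 1 / (b : ℂ)) / (lam q : ℂ)

/-- `y` is a root, in the closed unit disc, of
`lam_q y² - (lam_q + 1 / b + ∑_{m ≠ q} lam_m (1 - z_m)) y + 1 / b`. -/
def IsUnitDiscRoot {M : ℕ} (lam : Fin M → ℝ) (b : ℝ) (q : Fin M) (z : Fin M → ℂ) (y : ℂ) :
    Prop :=
  ‖y‖ ≤ 1 ∧
    (lam q : ℂ) * y ^ 2 - ((lam q : ℂ) + 1 / (b : ℂ) + otherRate lam q z) * y + 1 / (b : ℂ) = 0

/-- The lattice-path counts `c^n(i,j)`, `n, i, j ≥ 1`: `c^1(i,j) = 1` if `j ≥ i - 1` and `0`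
otherwise, and `c^n(i,j) = ∑_{l=1}^{j+1} c^{n-1}(i,l)` for `n ≥ 2`. So `c^n(i,j)` is the number
of paths `i = l_0, l_1, …, l_n = j` in the positive integers with `l_{t+1} ≥ l_t - 1`. (The
values with `n`, `i` or `j` equal to `0` are not used.) -/
def latticeCount : ℕ → ℕ → ℕ → ℕ
  | 0, _, _ => 0
  | 1, i, j => if i ≤ j + 1 then 1 else 0
  | n + 2, i, j => ∑ l ∈ Finset.Icc 1 (j + 1), latticeCount (n + 1) i l

/-- The series expression `S`, as a function of `k` and of the initial length `i` of the visited
queue; the sums over `j ≥ 1` are indexed by `j + 1` with `j : ℕ`. -/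
noncomputable def seriesS {M : ℕ} (lam : Fin M → ℝ) (b : ℝ) (q : Fin M) (z : Fin M → ℂ) (y : ℂ)
    (k i : ℕ) : ℂ :=
  (b : ℂ) * latticeCount (k - 1) i 1 / ((lam q : ℂ) * b) ^ k
        * xParam lam b q z ^ (-2 * (k : ℤ) + i)
    - (b : ℂ) * y ^ i
    - (b : ℂ) * xParam lam b q z ^ (-2 * (k : ℤ) + i + 1)
        / (((lam q : ℂ) * b) ^ k * (xParam lam b q z - z q))
        * ∑' j : ℕ, (latticeCount (k - 1) i (j + 1) : ℂ) * (z q / xParam lam b q z) ^ j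
    + (b : ℂ) * xParam lam b q z ^ (-2 * (k : ℤ) + i) / ((lam q : ℂ) * b) ^ k
        * ∑' j : ℕ, (latticeCount k i (j + 1) : ℂ) * (y / xParam lam b q z) ^ (j + 1)

end Polling

open Polling

/-!
Write `w = 1 / (lam q * b)` and `x = xParam lam b q z`, so that `1 + w ≤ re x` and hence `1 < |x|`.
The arrivals during the successive services of a visit are independent, identically distributed
vectors (`indepFun_past_arrivalsDuring`), and in one service of exponential length the joint weight
of `j` arrivals at queue `q` and of the generating function at the other queues is `w / x ^ (j + 1)`
(`integral_arrivalsDuring`). The queue lengths at the end of a visit are therefore those of a random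
walk stopped when queue `q` becomes empty or after `k` steps, and
`E[z ^ Nᵉ | Nb = i] = (∏_{m ≠ q} z_m ^ i_m) (T^k f) (i q)` with `f a = z q ^ a` and `T` the operator
`serviceOp w x` (`condPgf_endState`).

What remains is the computation of `T^k f`. For `k = 1, 2` it consists of geometric series. For
general `k`, a root `y` in the unit disc of `y (x - y) = w` makes `y ^ a` a fixed point of `T`
(optional stopping), and `g a = z q ^ a - y ^ a` vanishes at `0`, so that `T^k g` is a sum over the
paths that avoid `0`; as the weight of such a path depends on its length and its end points only,
it is a sum over the path counts (`iterate_serviceOp_eq_tsum`). The series of the `c^k (i, j)` at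
`z q / x` is finally reduced to that of the `c^(k - 1) (i, j)` by the last-step recursion
(`tsum_latticeCount_succ`).

Independence is established by conditioning on the service requirements. Reading the arrival
processes at random times is legitimate because right-continuous processes are jointly measurable
(`measurable_uncurry_of_rightCont`), and arrivals at fixed times are products of Poisson variables
(`integral_prod_increments`). All distributions of arrival counts are discrete, so that independence
amounts to a product formula for the probabilities of single values.
-/

namespace Polling

/-! ### Lattice-path counts -/

lemma latticeCount_le (n i j : ℕ) : latticeCount (n + 1) i j ≤ (j + n + 1) ^ n := by
  induction n generalizing j with
  | zero => simp only [latticeCount]; split_ifs <;> simp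
  | succ n ih =>
    simp only [latticeCount]
    calc ∑ l ∈ Finset.Icc 1 (j + 1), latticeCount (n + 1) i l
        ≤ ∑ _l ∈ Finset.Icc 1 (j + 1), (j + n + 2) ^ n :=
          Finset.sum_le_sum fun l hl => (ih l).trans
            (Nat.pow_le_pow_left (by have := (Finset.mem_Icc.1 hl).2; omega) n)
      _ = (j + 1) * (j + n + 2) ^ n := by simp
      _ ≤ (j + n + 2) * (j + n + 2) ^ n := Nat.mul_le_mul_right _ (by omega)
      _ = (j + (n + 1) + 1) ^ (n + 1) := by rw [pow_succ']; ring_nf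

/-- Path counts grow polynomially in the end point, so that their generating functions converge
absolutely in the open unit disc. -/
lemma summable_latticeCount_mul_pow (k i : ℕ) {r : ℝ} (hr0 : 0 ≤ r) (hr : r < 1) :
    Summable fun j : ℕ => (latticeCount k i (j + 1) : ℝ) * r ^ j := by
  rcases k with _ | n
  · simp [latticeCount]
  rcases hr0.eq_or_lt with rfl | hr0
  · refine summable_of_ne_finset_zero (s := {0}) fun j hj => ?_
    simp at hj; simp [hj]
  have h := summable_pow_mul_geometric_of_norm_lt_one (R := ℝ) n
    (by rwa [Real.norm_of_nonneg hr0.le] : ‖r‖ < 1)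
  have h2 := ((summable_nat_add_iff (n + 2)).2 h).mul_left ((r ^ (n + 2))⁻¹)
  refine Summable.of_nonneg_of_le (fun j => by positivity) (fun j => ?_) h2
  have h3 : (latticeCount (n + 1) i (j + 1) : ℝ) ≤ ((j + (n + 2) : ℕ) : ℝ) ^ n := by
    have := latticeCount_le n i (j + 1)
    calc (latticeCount (n + 1) i (j + 1) : ℝ) ≤ ((j + 1 + n + 1 : ℕ) : ℝ) ^ n := by
          exact_mod_cast this
      _ = _ := by congr 2; omega
  calc (latticeCount (n + 1) i (j + 1) : ℝ) * r ^ j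
      ≤ ((j + (n + 2) : ℕ) : ℝ) ^ n * r ^ j := by gcongr
    _ = _ := by rw [pow_add r j]; field_simp

lemma summable_latticeCount_mul_cpow (k i : ℕ) {u : ℂ} (hu : ‖u‖ < 1) :
    Summable fun j : ℕ => (latticeCount k i (j + 1) : ℂ) * u ^ j := by
  refine Summable.of_norm ?_
  simpa using summable_latticeCount_mul_pow k i (norm_nonneg u) hu

lemma summable_latticeCount_mul_cpow_succ (k i : ℕ) {u : ℂ} (hu : ‖u‖ < 1) :
    Summable fun j : ℕ => (latticeCount k i (j + 1) : ℂ) * u ^ (j + 1) := by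
  refine ((summable_latticeCount_mul_cpow k i hu).mul_right u).congr fun j => ?_
  ring

/-- The last-step recursion of the path counts, in terms of generating functions: multiplication
by `1 - u` turns the partial sums defining `c^{n+1}(i, ·)` into `c^n(i, ·)`. -/
lemma tsum_latticeCount_succ (n i : ℕ) {u : ℂ} (hu : ‖u‖ < 1) :
    ∑' j : ℕ, (latticeCount (n + 2) i (j + 1) : ℂ) * u ^ (j + 1) =
      (∑' j : ℕ, (latticeCount (n + 1) i (j + 1) : ℂ) * u ^ j) / (1 - u)
        - latticeCount (n + 1) i 1 := by
  have h1 : (1 - u) ≠ 0 := by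
    intro h
    have : u = 1 := by linear_combination -h
    simp [this] at hu
  have hs := summable_latticeCount_mul_cpow_succ (n + 2) i hu
  have hs0 : Summable fun j : ℕ => (latticeCount (n + 2) i j : ℂ) * u ^ j :=
    (summable_nat_add_iff 1).1 hs
  -- the end point `0` is not reached by a path, but the recursion extends to it with this value
  have hc0 : latticeCount (n + 2) i 0 = latticeCount (n + 1) i 1 := by simp [latticeCount]
  have hc (j : ℕ) : latticeCount (n + 2) i (j + 1) =
      latticeCount (n + 2) i j + latticeCount (n + 1) i (j + 2) := by
    simp only [latticeCount]
    rw [Finset.sum_Icc_succ_top (by omega : 1 ≤ j + 1 + 1)]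
  have e0 := hs0.tsum_eq_zero_add
  have e1 := (summable_latticeCount_mul_cpow (n + 1) i hu).tsum_eq_zero_add
  have e2 : ∑' j : ℕ, (latticeCount (n + 2) i (j + 1) : ℂ) * u ^ (j + 1) =
      u * ∑' j : ℕ, (latticeCount (n + 2) i j : ℂ) * u ^ j +
        ∑' j : ℕ, (latticeCount (n + 1) i (j + 1 + 1) : ℂ) * u ^ (j + 1) := by
    rw [← tsum_mul_left, ← (hs0.mul_left u).tsum_add
      ((summable_nat_add_iff (f := fun j : ℕ => (latticeCount (n + 1) i (j + 1) : ℂ) * u ^ j) 1).2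
        (summable_latticeCount_mul_cpow (n + 1) i hu))]
    refine tsum_congr fun j => ?_
    rw [hc]; push_cast; ring
  rw [eq_sub_iff_add_eq, eq_div_iff h1]
  simp only [hc0, pow_zero, mul_one, zero_add] at e0 e1
  linear_combination e2 + u * e0 - e1

/-! ### The one-service operator -/

/-- The effect of one service on a function `f` of the length of the visited queue: an empty queue
is left alone, and otherwise one job departs and `j` jobs arrive with weight `w / x ^ (j + 1)`. -/
noncomputable def serviceOp (w x : ℂ) (f : ℕ → ℂ) (a : ℕ) : ℂ :=
  if a = 0 then f 0 else ∑' j : ℕ, w / x ^ (j + 1) * f (a - 1 + j)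

lemma norm_serviceOp_term_le {w x : ℂ} {f : ℕ → ℂ} {C : ℝ} (hf : ∀ a, ‖f a‖ ≤ C) (j a : ℕ) :
    ‖w / x ^ (j + 1) * f a‖ ≤ ‖w‖ * ‖x‖⁻¹ * C * ‖x‖⁻¹ ^ j := by
  rw [norm_mul, norm_div, norm_pow]
  calc ‖w‖ / ‖x‖ ^ (j + 1) * ‖f a‖ ≤ ‖w‖ / ‖x‖ ^ (j + 1) * C := by gcongr; exact hf a
    _ = _ := by rw [inv_pow, pow_succ, div_eq_mul_inv, mul_inv]; ring

lemma summable_serviceOp_bound {x : ℂ} (hx : 1 < ‖x‖) (c : ℝ) :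
    Summable fun j : ℕ => c * ‖x‖⁻¹ ^ j :=
  (summable_geometric_of_lt_one (by positivity) (inv_lt_one_of_one_lt₀ hx)).mul_left c

lemma summable_serviceOp {w x : ℂ} (hx : 1 < ‖x‖) {f : ℕ → ℂ} {C : ℝ} (hf : ∀ a, ‖f a‖ ≤ C)
    (g : ℕ → ℕ) : Summable fun j : ℕ => w / x ^ (j + 1) * f (g j) :=
  Summable.of_norm_bounded (summable_serviceOp_bound hx _)
    fun j => norm_serviceOp_term_le hf j (g j)

lemma exists_bound_serviceOp {w x : ℂ} (hx : 1 < ‖x‖) {f : ℕ → ℂ} (hf : ∃ C, ∀ a, ‖f a‖ ≤ C) :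
    ∃ C, ∀ a, ‖serviceOp w x f a‖ ≤ C := by
  obtain ⟨C, hC⟩ := hf
  refine ⟨max C (∑' j : ℕ, ‖w‖ * ‖x‖⁻¹ * C * ‖x‖⁻¹ ^ j), fun a => ?_⟩
  unfold serviceOp
  split_ifs
  · exact (hC 0).trans (le_max_left _ _)
  · exact (tsum_of_norm_bounded (summable_serviceOp_bound hx _).hasSum
      fun j => norm_serviceOp_term_le hC j _).trans (le_max_right _ _)

lemma serviceOp_sub {w x : ℂ} (hx : 1 < ‖x‖) {f g : ℕ → ℂ} (hf : ∃ C, ∀ a, ‖f a‖ ≤ C)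
    (hg : ∃ C, ∀ a, ‖g a‖ ≤ C) :
    serviceOp w x (f - g) = serviceOp w x f - serviceOp w x g := by
  obtain ⟨C, hC⟩ := hf
  obtain ⟨D, hD⟩ := hg
  ext a
  simp only [serviceOp, Pi.sub_apply]
  split_ifs
  · rfl
  · rw [← (summable_serviceOp hx hC _).tsum_sub (summable_serviceOp hx hD _)]
    exact tsum_congr fun j => mul_sub _ _ _

lemma iterate_serviceOp_sub {w x : ℂ} (hx : 1 < ‖x‖) (k : ℕ) {f g : ℕ → ℂ}
    (hf : ∃ C, ∀ a, ‖f a‖ ≤ C) (hg : ∃ C, ∀ a, ‖g a‖ ≤ C) :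
    (serviceOp w x)^[k] (f - g) = (serviceOp w x)^[k] f - (serviceOp w x)^[k] g := by
  induction k generalizing f g with
  | zero => rfl
  | succ k ih =>
    simp only [Function.iterate_succ_apply]
    rw [serviceOp_sub hx hf hg, ih (exists_bound_serviceOp hx hf) (exists_bound_serviceOp hx hg)]

lemma exists_bound_pow {v : ℂ} (hv : ‖v‖ ≤ 1) : ∃ C : ℝ, ∀ a : ℕ, ‖v ^ a‖ ≤ C :=
  ⟨1, fun a => by rw [norm_pow]; exact pow_le_one₀ (norm_nonneg v) hv⟩

lemma sub_ne_zero_of_norm_lt {x v : ℂ} (hx : 1 < ‖x‖) (hv : ‖v‖ ≤ 1) : x - v ≠ 0 := by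
  intro h
  rw [sub_eq_zero.1 h] at hx
  exact absurd hv (not_le.2 hx)

lemma norm_div_lt_one {x v : ℂ} (hx : 1 < ‖x‖) (hv : ‖v‖ ≤ 1) : ‖v / x‖ < 1 := by
  rw [norm_div, div_lt_one (by linarith)]
  linarith

lemma hasSum_service_weights {w x v : ℂ} (hx : 1 < ‖x‖) (hv : ‖v‖ ≤ 1) (a : ℕ) :
    HasSum (fun j : ℕ => w / x ^ (j + 1) * v ^ (a + j)) (w * v ^ a / (x - v)) := by
  have hx0 : x ≠ 0 := norm_pos_iff.1 (by linarith)
  have h := (hasSum_geometric_of_norm_lt_one (norm_div_lt_one hx hv)).mul_left (w * v ^ a / x)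
  have hxv := sub_ne_zero_of_norm_lt hx hv
  have e1 : w * v ^ a / x * (1 - v / x)⁻¹ = w * v ^ a / (x - v) := by
    rw [one_sub_div hx0]; field_simp
  rw [e1] at h
  refine h.congr_fun fun j => ?_
  rw [pow_add v, div_pow, pow_succ]; field_simp

lemma serviceOp_pow {w x v : ℂ} (hx : 1 < ‖x‖) (hv : ‖v‖ ≤ 1) {a : ℕ} (ha : a ≠ 0) :
    serviceOp w x (fun n => v ^ n) a = w * v ^ (a - 1) / (x - v) := by
  rw [serviceOp, if_neg ha]
  exact (hasSum_service_weights hx hv (a - 1)).tsum_eq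

/-- The powers of a root `y` of `y (x - y) = w` in the unit disc are harmonic for a service. -/
lemma iterate_serviceOp_root {w x y : ℂ} (hx : 1 < ‖x‖) (hy : ‖y‖ ≤ 1) (hw : w = y * (x - y))
    (k : ℕ) : (serviceOp w x)^[k] (fun n => y ^ n) = fun n => y ^ n := by
  refine Function.iterate_fixed ?_ k
  ext a
  rcases Nat.eq_zero_or_pos a with rfl | ha
  · simp [serviceOp]
  · rw [serviceOp_pow hx hy ha.ne', hw, div_eq_iff (sub_ne_zero_of_norm_lt hx hy)]
    obtain ⟨b, rfl⟩ : ∃ b, a = b + 1 := ⟨a - 1, by omega⟩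
    simp only [Nat.add_sub_cancel, pow_succ]; ring

/-- Two services, from a queue of length `1`. -/
lemma serviceOp_serviceOp_pow_one {w x v : ℂ} (hx : 1 < ‖x‖) (hv : ‖v‖ ≤ 1) :
    serviceOp w x (serviceOp w x fun n => v ^ n) 1 = w / x * (w / (x - v) ^ 2 + 1) := by
  have hx0 : x ≠ 0 := norm_pos_iff.1 (by linarith)
  have hb := exists_bound_serviceOp (w := w) hx (exists_bound_pow hv)
  obtain ⟨C, hC⟩ := hb
  rw [serviceOp, if_neg one_ne_zero, (summable_serviceOp hx hC _).tsum_eq_zero_add]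
  have h : ∀ j : ℕ, w / x ^ (j + 1 + 1) * serviceOp w x (fun n => v ^ n) (1 - 1 + (j + 1)) =
      w / (x * (x - v)) * (w / x ^ (j + 1) * v ^ (0 + j)) := by
    intro j
    rw [serviceOp_pow hx hv (by omega)]
    simp only [tsub_self, zero_add, Nat.add_sub_cancel]
    rw [pow_succ x (j + 1)]; field_simp
  simp_rw [h]
  rw [tsum_mul_left, (hasSum_service_weights hx hv 0).tsum_eq]
  have := sub_ne_zero_of_norm_lt hx hv
  simp [serviceOp]
  field_simp
  ring

/-- Two services, from a queue of length at least `2`. -/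
lemma serviceOp_serviceOp_pow {w x v : ℂ} (hx : 1 < ‖x‖) (hv : ‖v‖ ≤ 1) {a : ℕ} (ha : 2 ≤ a) :
    serviceOp w x (serviceOp w x fun n => v ^ n) a = w ^ 2 * v ^ (a - 2) / (x - v) ^ 2 := by
  have := sub_ne_zero_of_norm_lt hx hv
  rw [serviceOp, if_neg (by omega)]
  have h : ∀ j : ℕ, w / x ^ (j + 1) * serviceOp w x (fun n => v ^ n) (a - 1 + j) =
      w / (x - v) * (w / x ^ (j + 1) * v ^ (a - 2 + j)) := by
    intro j
    rw [serviceOp_pow hx hv (by omega), show a - 1 + j - 1 = a - 2 + j by omega]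
    ring
  simp_rw [h]
  rw [tsum_mul_left, (hasSum_service_weights hx hv _).tsum_eq]
  field_simp

lemma serviceOp_eq_tsum {w x : ℂ} (hx : x ≠ 0) {f : ℕ → ℂ} (hf : f 0 = 0) {a : ℕ} (ha : 1 ≤ a) :
    serviceOp w x f a =
      ∑' l : ℕ, (latticeCount 1 a (l + 1) : ℂ) * (w * x ^ a / x ^ (l + 3)) * f (l + 1) := by
  rw [serviceOp, if_neg (by omega)]
  -- both sums are the sum over the new queue length `l ≥ a - 1`
  have h1 : ∑' j : ℕ, w / x ^ (j + 1) * f (a - 1 + j) =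
      ∑' l : ℕ, (if a ≤ l + 1 then w * x ^ a / x ^ (l + 2) * f l else 0) := by
    rw [← (add_right_injective (a - 1)).tsum_eq (f := fun l : ℕ =>
      if a ≤ l + 1 then w * x ^ a / x ^ (l + 2) * f l else 0)]
    · refine tsum_congr fun j => ?_
      rw [if_pos (by omega), show a - 1 + j + 2 = (j + 1) + a by omega, pow_add x (j + 1) a]
      field_simp
    · intro l hl
      rw [Function.mem_support] at hl
      have : a ≤ l + 1 := by by_contra h; rw [if_neg h] at hl; exact hl rfl
      exact ⟨l - (a - 1), by simp only; omega⟩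
  have h2 : ∑' l : ℕ, (if a ≤ l + 1 then w * x ^ a / x ^ (l + 2) * f l else 0) =
      ∑' l : ℕ, (if a ≤ l + 1 + 1 then w * x ^ a / x ^ (l + 1 + 2) * f (l + 1) else 0) := by
    rw [← (add_left_injective 1).tsum_eq]
    intro l hl
    rw [Function.mem_support] at hl
    rcases l with _ | l
    · simp [hf] at hl
    · exact ⟨l, rfl⟩
  rw [h1, h2]
  refine tsum_congr fun l => ?_
  simp only [latticeCount]
  split_ifs <;> simp

/-- For a function that vanishes at an empty queue only the paths that avoid `0` matter. Since `n`
steps from `i` to `j` have the weight `w ^ n * x ^ i / x ^ (j + 2 * n)` along every path, the result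
is a sum over the path counts. -/
lemma iterate_serviceOp_eq_tsum {w x : ℂ} (hx : 1 < ‖x‖) (n : ℕ) {f : ℕ → ℂ}
    (hb : ∃ C, ∀ a, ‖f a‖ ≤ C) (hf : f 0 = 0) {i : ℕ} (hi : 1 ≤ i) :
    (serviceOp w x)^[n + 1] f i = ∑' l : ℕ, (latticeCount (n + 1) i (l + 1) : ℂ) *
      (w ^ (n + 1) * x ^ i / x ^ (l + 1 + 2 * (n + 1))) * f (l + 1) := by
  have hx0 : x ≠ 0 := norm_pos_iff.1 (by linarith)
  induction n generalizing f with
  | zero =>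
    simp only [zero_add, Function.iterate_one]
    rw [serviceOp_eq_tsum hx0 hf hi]
    simp
  | succ n ih =>
    rw [Function.iterate_succ_apply, ih (exists_bound_serviceOp hx hb) (by simp [serviceOp, hf])]
    -- `F l j`: the length is `j + 1` before the last step and `l + 1` after it
    set F : ℕ → ℕ → ℂ := fun l j => (latticeCount (n + 1) i (j + 1) : ℂ) *
      (latticeCount 1 (j + 1) (l + 1) : ℂ) *
      (w ^ (n + 2) * x ^ i / x ^ (l + 1 + 2 * (n + 2)) * f (l + 1)) with hF
    have hF0 : ∀ l, ∀ j ∉ Finset.range (l + 2), F l j = 0 := by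
      intro l j hj
      have : ¬ j + 1 ≤ l + 1 + 1 := by have := mt Finset.mem_range.2 hj; omega
      simp only [hF, latticeCount, if_neg this]; simp
    have hcount (l : ℕ) : ∑ j ∈ Finset.range (l + 2),
        latticeCount (n + 1) i (j + 1) * latticeCount 1 (j + 1) (l + 1) =
          latticeCount (n + 2) i (l + 1) := by
      rw [show latticeCount (n + 2) i (l + 1) =
        ∑ m ∈ Finset.Icc 1 (l + 1 + 1), latticeCount (n + 1) i m from rfl,
        ← Finset.Ico_add_one_right_eq_Icc, Finset.sum_Ico_eq_sum_range]
      refine Finset.sum_congr (by simp) fun j hj => ?_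
      have : j + 1 ≤ l + 1 + 1 := by have := Finset.mem_range.1 hj; omega
      rw [show latticeCount 1 (j + 1) (l + 1) = if j + 1 ≤ l + 1 + 1 then 1 else 0 from rfl,
        if_pos this, mul_one, add_comm 1 j]
    have hsum : Summable (Function.uncurry F) := by
      refine Summable.of_norm ?_
      rw [summable_prod_of_nonneg (fun p => norm_nonneg _)]
      refine ⟨fun l => summable_of_ne_finset_zero (s := Finset.range (l + 2))
        fun j hj => by simp [Function.uncurry, hF0 l j hj], ?_⟩
      obtain ⟨C, hC⟩ := hb
      have hs := (summable_latticeCount_mul_pow (n + 2) i (r := ‖x‖⁻¹) (by positivity)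
        (inv_lt_one_of_one_lt₀ hx)).mul_right
          (‖w‖ ^ (n + 2) * ‖x‖ ^ i * (‖x‖⁻¹) ^ (1 + 2 * (n + 2)) * C)
      refine Summable.of_nonneg_of_le (fun l => tsum_nonneg fun j => norm_nonneg _) (fun l => ?_) hs
      rw [tsum_eq_sum (s := Finset.range (l + 2))
        fun j hj => by simp [Function.uncurry, hF0 l j hj]]
      simp only [Function.uncurry, hF, norm_mul, Complex.norm_natCast, norm_div, norm_pow]
      rw [← Finset.sum_mul, ← hcount]
      push_cast
      have e : ‖w‖ ^ (n + 2) * ‖x‖ ^ i / ‖x‖ ^ (l + 1 + 2 * (n + 2)) * ‖f (l + 1)‖ ≤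
          ‖x‖⁻¹ ^ l * (‖w‖ ^ (n + 2) * ‖x‖ ^ i * (‖x‖⁻¹) ^ (1 + 2 * (n + 2)) * C) := by
        calc _ ≤ ‖w‖ ^ (n + 2) * ‖x‖ ^ i / ‖x‖ ^ (l + 1 + 2 * (n + 2)) * C := by
              gcongr; exact hC _
          _ = _ := by
            rw [show l + 1 + 2 * (n + 2) = l + (1 + 2 * (n + 2)) by ring, pow_add ‖x‖ l, inv_pow,
              inv_pow]
            field_simp
      calc _ ≤ _ := mul_le_mul_of_nonneg_left e (by positivity)
        _ = _ := by ring
    calc _ = ∑' j, ∑' l, F l j := by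
          refine tsum_congr fun j => ?_
          rw [serviceOp_eq_tsum hx0 hf (by omega), ← tsum_mul_left]
          refine tsum_congr fun l => ?_
          simp only [hF]
          rw [show l + 1 + 2 * (n + 2) = (l + 3) + 2 * (n + 1) by ring,
            show j + 1 + 2 * (n + 1) = (j + 1) + 2 * (n + 1) by ring, pow_add x (l + 3),
            pow_add x (j + 1)]
          field_simp
          ring
      _ = ∑' l, ∑' j, F l j := hsum.tsum_comm
      _ = _ := by
          refine tsum_congr fun l => ?_
          rw [tsum_eq_sum (hF0 l)]
          simp only [hF]
          rw [← Finset.sum_mul, show n + 1 + 1 = n + 2 from rfl, ← hcount]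
          push_cast
          ring

/-- Optional stopping at the harmonic function `y ^ n`, followed by the reduction of the count of
the last step. -/
lemma iterate_serviceOp_pow {w x y v : ℂ} (hx : 1 < ‖x‖) (hy : ‖y‖ ≤ 1) (hv : ‖v‖ ≤ 1)
    (hw : w = y * (x - y)) (n : ℕ) {i : ℕ} (hi : 1 ≤ i) :
    (serviceOp w x)^[n + 2] (fun a => v ^ a) i =
      y ^ i - w ^ (n + 2) * (x ^ i / x ^ (2 * (n + 2))) * latticeCount (n + 1) i 1
      + w ^ (n + 2) * (x ^ i / x ^ (2 * (n + 2))) * x / (x - v) *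
          ∑' j : ℕ, (latticeCount (n + 1) i (j + 1) : ℂ) * (v / x) ^ j
      - w ^ (n + 2) * (x ^ i / x ^ (2 * (n + 2))) *
          ∑' j : ℕ, (latticeCount (n + 2) i (j + 1) : ℂ) * (y / x) ^ (j + 1) := by
  have hx0 : x ≠ 0 := norm_pos_iff.1 (by linarith)
  have hxv := sub_ne_zero_of_norm_lt hx hv
  have h0 := congrFun (iterate_serviceOp_sub (w := w) hx (n + 2) (exists_bound_pow hv)
    (exists_bound_pow hy)) i
  rw [iterate_serviceOp_root hx hy hw, Pi.sub_apply] at h0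
  have hb : ∃ C : ℝ, ∀ a : ℕ, ‖((fun a => v ^ a) - fun a => y ^ a : ℕ → ℂ) a‖ ≤ C := by
    obtain ⟨C, hC⟩ := exists_bound_pow hv
    obtain ⟨D, hD⟩ := exists_bound_pow hy
    exact ⟨C + D, fun a => (norm_sub_le _ _).trans (add_le_add (hC a) (hD a))⟩
  rw [iterate_serviceOp_eq_tsum hx (n + 1) hb (by simp) hi] at h0
  have hS : ∑' l : ℕ, (latticeCount (n + 1 + 1) i (l + 1) : ℂ) *
      (w ^ (n + 1 + 1) * x ^ i / x ^ (l + 1 + 2 * (n + 1 + 1))) *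
        ((fun a => v ^ a) - fun a => y ^ a : ℕ → ℂ) (l + 1) =
      w ^ (n + 2) * (x ^ i / x ^ (2 * (n + 2))) *
        ((∑' j : ℕ, (latticeCount (n + 2) i (j + 1) : ℂ) * (v / x) ^ (j + 1)) -
          ∑' j : ℕ, (latticeCount (n + 2) i (j + 1) : ℂ) * (y / x) ^ (j + 1)) := by
    rw [← (summable_latticeCount_mul_cpow_succ _ i (norm_div_lt_one hx hv)).tsum_sub
      (summable_latticeCount_mul_cpow_succ _ i (norm_div_lt_one hx hy)), ← tsum_mul_left]
    refine tsum_congr fun l => ?_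
    simp only [Pi.sub_apply, div_pow]
    rw [pow_add x (l + 1)]
    field_simp
  rw [hS, tsum_latticeCount_succ n i (norm_div_lt_one hx hv), one_sub_div hx0] at h0
  rw [show (∑' j : ℕ, (latticeCount (n + 1) i (j + 1) : ℂ) * (v / x) ^ j) / ((x - v) / x) =
    x / (x - v) * ∑' j : ℕ, (latticeCount (n + 1) i (j + 1) : ℂ) * (v / x) ^ j by
      field_simp] at h0
  linear_combination -h0

/-! ### Processes at random times -/

/-- A right-continuous process is jointly measurable: it is the limit of the processes read at the
next point of the grid `ℕ / (n + 1)`. -/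
lemma measurable_uncurry_of_rightCont {F : Type*} [MeasurableSpace F] {A : ℝ≥0 → F → ℕ}
    (hm : ∀ t, Measurable (A t))
    (hr : ∀ ω t, ContinuousWithinAt (fun s => A s ω) (Set.Ici t) t) :
    Measurable fun p : ℝ≥0 × F => A p.1 p.2 := by
  obtain ⟨D, hD⟩ : ∃ D : ℕ → ℕ → ℝ≥0, ∀ n j, D n j = ((j : ℝ≥0) + 1) / (n + 1) :=
    ⟨_, fun _ _ => rfl⟩
  refine measurable_of_tendsto_metrizable
    (f := fun (n : ℕ) (p : ℝ≥0 × F) => A (D n ⌊p.1 * ((n : ℝ≥0) + 1)⌋₊) p.2) (fun n => ?_) ?_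
  · have h1 : Measurable fun r : ℕ × F => A (D n r.1) r.2 :=
      measurable_from_prod_countable_right fun j => hm (D n j)
    have h2 : Measurable fun p : ℝ≥0 × F => (⌊p.1 * ((n : ℝ≥0) + 1)⌋₊, p.2) :=
      (Nat.measurable_floor.comp (measurable_fst.mul_const _)).prodMk measurable_snd
    exact h1.comp h2
  · rw [tendsto_pi_nhds]
    rintro ⟨t, ω⟩
    refine (hr ω t).tendsto.comp (tendsto_nhdsWithin_iff.2 ⟨?_, ?_⟩)
    · have hlim : Filter.Tendsto (fun n : ℕ => t + 1 / ((n : ℝ≥0) + 1)) Filter.atTop (nhds t) := by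
        have h0 : Filter.Tendsto (fun n : ℕ => 1 / ((n : ℝ≥0) + 1)) Filter.atTop (nhds 0) :=
          tendsto_one_div_add_atTop_nhds_zero_nat
        simpa using h0.const_add t
      refine tendsto_of_tendsto_of_tendsto_of_le_of_le tendsto_const_nhds hlim (fun n => ?_)
        (fun n => ?_)
      · have hn : (0 : ℝ≥0) < n + 1 := by positivity
        rw [hD]
        exact (le_div_iff₀ hn).2 (Nat.lt_floor_add_one _).le
      · have hn : (0 : ℝ≥0) < n + 1 := by positivity
        rw [hD]
        refine (div_le_iff₀ hn).2 ?_
        rw [add_mul, one_div, inv_mul_cancel₀ hn.ne']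
        gcongr
        exact Nat.floor_le zero_le
    · refine Filter.Eventually.of_forall fun n => ?_
      have hn : (0 : ℝ≥0) < n + 1 := by positivity
      change t ≤ D n _
      rw [hD]
      exact (le_div_iff₀ hn).2 (Nat.lt_floor_add_one _).le

/-- The space of right-continuous vectors of paths, with the σ-algebra generated by the
evaluations at fixed times. -/
abbrev PathSpace (M : ℕ) : Type :=
  {a : Fin M → ℝ≥0 → ℕ // ∀ m t, ContinuousWithinAt (a m) (Set.Ici t) t}

lemma measurable_eval_path {M : ℕ} (m : Fin M) :
    Measurable fun p : ℝ≥0 × PathSpace M => p.2.1 m p.1 :=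
  measurable_uncurry_of_rightCont (A := fun t (a : PathSpace M) => a.1 m t)
    (fun t => (measurable_pi_apply t).comp ((measurable_pi_apply m).comp measurable_subtype_coe))
    (fun a t => a.2 m t)

section Independence

variable {Ω E F G : Type*} [MeasurableSpace Ω] [MeasurableSpace E] [MeasurableSpace F]
  [MeasurableSpace G] {P : Measure Ω}

lemma indepFun_of_comap_le {X : Ω → E} {Y : Ω → F} {W : Ω → G} (h : IndepFun X Y P)
    (hW : Measurable[MeasurableSpace.comap Y inferInstance] W) : IndepFun X W P := by
  rw [IndepFun_iff_Indep] at h ⊢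
  exact indep_of_indep_of_le_right h hW.comap_le

/-- Conditioning on one of two independent random elements. -/
lemma integral_comp_of_indepFun [IsProbabilityMeasure P] {X : Ω → E} {W : Ω → F}
    (hX : Measurable X) (hW : Measurable W) (h : IndepFun X W P) {g : E × F → ℂ}
    (hg : Measurable g) {C : ℝ} (hC : ∀ p, ‖g p‖ ≤ C) :
    ∫ ω, g (X ω, W ω) ∂P = ∫ ω, ∫ ω', g (X ω, W ω') ∂P ∂P := by
  have : IsProbabilityMeasure (P.map X) := Measure.isProbabilityMeasure_map hX.aemeasurable
  have : IsProbabilityMeasure (P.map W) := Measure.isProbabilityMeasure_map hW.aemeasurable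
  have hi : Integrable g ((P.map X).prod (P.map W)) :=
    Integrable.of_bound hg.aestronglyMeasurable C (Filter.Eventually.of_forall hC)
  rw [← integral_map (hX.prodMk hW).aemeasurable hg.aestronglyMeasurable,
    h.map_prod_eq_prod_map_map hX.aemeasurable hW.aemeasurable, integral_prod _ hi,
    integral_map hX.aemeasurable
      hg.stronglyMeasurable.integral_prod_right'.aestronglyMeasurable]
  refine integral_congr_ae (Filter.Eventually.of_forall fun ω => ?_)
  exact integral_map hW.aemeasurable (hg.comp measurable_prodMk_left).aestronglyMeasurable

end Independence

/-! ### Arrivals during the successive services -/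

section Model

variable {Ω : Type*} [MeasurableSpace Ω] {P : Measure Ω} {M : ℕ} {lam : Fin M → ℝ} {b : ℝ}
  {Nb : Ω → Fin M → ℕ} {A : Fin M → ℝ≥0 → Ω → ℕ} {S : ℕ → Ω → ℝ≥0}

/-- The numbers of arrivals at the queues during the `(n+1)`-st service. -/
noncomputable def arrivalsDuring (A : Fin M → ℝ≥0 → Ω → ℕ) (S : ℕ → Ω → ℝ≥0) (n : ℕ) (ω : Ω) :
    Fin M → ℕ :=
  fun m => A m (departureTime S (n + 1) ω) ω - A m (departureTime S n ω) ω

/-- `arrivalsDuring` as a function of the sequence of service requirements and the paths of the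
arrival processes. -/
noncomputable def pathArrivals (n : ℕ) (p : (ℕ → ℝ≥0) × PathSpace M) : Fin M → ℕ :=
  fun m => p.2.1 m (∑ r ∈ Finset.range (n + 1), p.1 r) - p.2.1 m (∑ r ∈ Finset.range n, p.1 r)

lemma measurable_pathArrivals (n : ℕ) :
    Measurable (pathArrivals (M := M) n) := by
  have hsum (n : ℕ) : Measurable fun p : (ℕ → ℝ≥0) × PathSpace M =>
      ∑ r ∈ Finset.range n, p.1 r :=
    Finset.measurable_sum _ fun r _ => (measurable_pi_apply r).comp measurable_fst
  refine measurable_pi_lambda _ fun m => ?_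
  have h (n : ℕ) := (measurable_eval_path m).comp ((hsum n).prodMk measurable_snd)
  exact (Measurable.of_discrete (f := fun r : ℕ × ℕ => r.1 - r.2)).comp
    ((h (n + 1)).prodMk (h n))

/-- The paths of the arrival processes as a random element of `PathSpace`. -/
def arrivalPaths (hmodel : IsVisitModel P lam b Nb A S) (ω : Ω) : PathSpace M :=
  ⟨fun m t => A m t ω, fun m t => (hmodel.poisson m).rightCont ω t⟩

lemma measurable_arrivalPaths (hmodel : IsVisitModel P lam b Nb A S) :
    Measurable (arrivalPaths hmodel) :=
  (measurable_pi_lambda _ fun m => measurable_pi_lambda _ fun t =>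
    (hmodel.poisson m).measurable t).subtype_mk

lemma measurable_services (hmodel : IsVisitModel P lam b Nb A S) :
    Measurable fun ω n => S n ω :=
  measurable_pi_lambda _ hmodel.measurable_service

lemma measurable_arrivalsDuring (hmodel : IsVisitModel P lam b Nb A S) (n : ℕ) :
    Measurable (arrivalsDuring A S n) :=
  (measurable_pathArrivals n).comp
    ((measurable_services hmodel).prodMk (measurable_arrivalPaths hmodel))

lemma indepFun_services_arrivalPaths (hmodel : IsVisitModel P lam b Nb A S) :
    IndepFun (fun ω n => S n ω) (arrivalPaths hmodel) P :=
  indepFun_of_comap_le hmodel.service_arrival_indep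
    (Measurable.subtype_mk (comap_measurable _))

lemma indepFun_begin_arrivalsDuring (hmodel : IsVisitModel P lam b Nb A S) :
    IndepFun Nb (fun ω n => arrivalsDuring A S n ω) P := by
  have h : IndepFun Nb (fun ω => ((fun n => S n ω), arrivalPaths hmodel ω)) P := by
    refine indepFun_of_comap_le hmodel.begin_indep ?_
    have hc := comap_measurable (m := inferInstance)
      (fun ω : Ω => ((fun n : ℕ => S n ω), fun (m : Fin M) (t : ℝ≥0) => A m t ω))
    exact (measurable_fst.comp hc).prodMk (Measurable.subtype_mk (measurable_snd.comp hc))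
  exact h.comp measurable_id (measurable_pi_lambda _ fun n => measurable_pathArrivals n)

lemma integral_prod_increments (hmodel : IsVisitModel P lam b Nb A S) {t : ℕ → ℝ≥0}
    (ht : Monotone t) (k : ℕ) (φ : ℕ → Fin M → ℕ → ℂ) :
    ∫ ω, ∏ n ∈ Finset.range k, ∏ m, φ n m (A m (t (n + 1)) ω - A m (t n) ω) ∂P =
      ∏ n ∈ Finset.range k, ∏ m,
        ∫ j, φ n m j ∂poissonMeasure (lam m * ((t (n + 1) : ℝ) - t n)).toNNReal := by
  have hφ (n m) : Measurable fun r : ℕ × ℕ => φ n m (r.1 - r.2) := .of_discrete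
  have hf (m) : Measurable fun a : ℝ≥0 → ℕ =>
      ∏ n ∈ Finset.range k, φ n m (a (t (n + 1)) - a (t n)) :=
    Finset.measurable_fun_prod _ fun n _ =>
      (hφ n m).comp (f := fun a : ℝ≥0 → ℕ => (a (t (n + 1)), a (t n)))
        ((measurable_pi_apply _).prodMk (measurable_pi_apply _))
  calc _ = ∫ ω, ∏ m, (fun a : ℝ≥0 → ℕ =>
          ∏ n ∈ Finset.range k, φ n m (a (t (n + 1)) - a (t n))) (fun t => A m t ω) ∂P := by
        refine integral_congr_ae (Filter.Eventually.of_forall fun ω => ?_)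
        exact Finset.prod_comm
    _ = ∏ m, ∫ ω, ∏ n ∈ Finset.range k, φ n m (A m (t (n + 1)) ω - A m (t n) ω) ∂P :=
        hmodel.arrival_indep.integral_fun_prod_comp
          (fun m => (measurable_pi_lambda _ (hmodel.poisson m).measurable).aemeasurable)
          (fun m => (hf m).aestronglyMeasurable)
    _ = ∏ m, ∏ n ∈ Finset.range k,
          ∫ j, φ n m j ∂poissonMeasure (lam m * ((t (n + 1) : ℝ) - t n)).toNNReal := by
        refine Finset.prod_congr rfl fun m _ => ?_
        have hi := ((hmodel.poisson m).indep.nat ht).precomp (g := ((↑) : Fin k → ℕ))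
          Fin.val_injective
        have hmeas (n : ℕ) : Measurable fun ω => A m (t (n + 1)) ω - A m (t n) ω :=
          (Measurable.of_discrete (f := fun r : ℕ × ℕ => r.1 - r.2)).comp
            (((hmodel.poisson m).measurable _).prodMk ((hmodel.poisson m).measurable _))
        have := hi.integral_fun_prod_comp (f := fun n : Fin k => φ n m)
          (fun n => (hmeas n).aemeasurable) (fun n => Measurable.of_discrete.aestronglyMeasurable)
        simp only [Finset.prod_range]
        refine this.trans (Finset.prod_congr rfl fun n _ => ?_)
        exact ((hmodel.poisson m).law _ _ (ht (Nat.le_succ _))).integral_comp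
          Measurable.of_discrete.aestronglyMeasurable
    _ = _ := Finset.prod_comm

/-- By joint measurability of the arrival process, as this is the mean of `φ (A m s)`. -/
lemma measurable_integral_poisson (hmodel : IsVisitModel P lam b Nb A S) [IsProbabilityMeasure P]
    (m : Fin M) (φ : ℕ → ℂ) :
    Measurable fun s : ℝ≥0 => ∫ j, φ j ∂poissonMeasure (lam m * (s : ℝ)).toNNReal := by
  have h : (fun s : ℝ≥0 => ∫ j, φ j ∂poissonMeasure (lam m * (s : ℝ)).toNNReal) =
      fun s => ∫ ω, φ (A m s ω) ∂P := by
    ext s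
    have := ((hmodel.poisson m).law 0 s zero_le).integral_comp (f := φ)
      Measurable.of_discrete.aestronglyMeasurable
    simpa [Function.comp_def, (hmodel.poisson m).zero] using this.symm
  rw [h]
  have hj := measurable_uncurry_of_rightCont (hmodel.poisson m).measurable
    (hmodel.poisson m).rightCont
  exact
    ((Measurable.of_discrete (f := φ)).comp hj).stronglyMeasurable.integral_prod_right'.measurable

/-- The arrivals during different services are independent, and given a service requirement `s`
the arrivals at queue `m` have the Poisson distribution of mean `lam m * s`. -/
lemma integral_prod_arrivalsDuring (hmodel : IsVisitModel P lam b Nb A S)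
    [IsProbabilityMeasure P] (k : ℕ) (φ : ℕ → Fin M → ℕ → ℂ)
    (hφ : ∀ n m, ∃ C, ∀ j, ‖φ n m j‖ ≤ C) :
    ∫ ω, ∏ n ∈ Finset.range k, ∏ m, φ n m (arrivalsDuring A S n ω m) ∂P =
      ∏ n ∈ Finset.range k, ∫ ω, ∏ m,
        ∫ j, φ n m j ∂poissonMeasure (lam m * (S n ω : ℝ)).toNNReal ∂P := by
  choose C hC using hφ
  have hg : Measurable fun p : (ℕ → ℝ≥0) × PathSpace M =>
      ∏ n ∈ Finset.range k, ∏ m, φ n m (pathArrivals n p m) :=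
    Finset.measurable_fun_prod _ fun n _ => Finset.measurable_fun_prod _ fun m _ =>
      (Measurable.of_discrete (f := φ n m)).comp
        ((measurable_pi_apply m).comp (measurable_pathArrivals n))
  have hb : ∀ p : (ℕ → ℝ≥0) × PathSpace M,
      ‖∏ n ∈ Finset.range k, ∏ m, φ n m (pathArrivals n p m)‖ ≤
        ∏ n ∈ Finset.range k, ∏ m, C n m := by
    intro p
    simp only [norm_prod]
    exact Finset.prod_le_prod (fun _ _ => Finset.prod_nonneg fun _ _ => norm_nonneg _)
      fun n _ => Finset.prod_le_prod (fun _ _ => norm_nonneg _) fun m _ => hC n m _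
  have h1 := integral_comp_of_indepFun (measurable_services hmodel)
    (measurable_arrivalPaths hmodel) (indepFun_services_arrivalPaths hmodel) hg hb
  refine h1.trans ?_
  have h2 (ω : Ω) : ∫ ω', ∏ n ∈ Finset.range k, ∏ m,
      φ n m (pathArrivals n (fun n => S n ω, arrivalPaths hmodel ω') m) ∂P =
      ∏ n ∈ Finset.range k, ∏ m,
        ∫ j, φ n m j ∂poissonMeasure (lam m * (S n ω : ℝ)).toNNReal := by
    have ht : Monotone fun n => ∑ r ∈ Finset.range n, S r ω :=
      monotone_nat_of_le_succ fun n => by rw [Finset.sum_range_succ]; exact le_self_add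
    refine (integral_prod_increments hmodel ht k φ).trans ?_
    refine Finset.prod_congr rfl fun n _ => Finset.prod_congr rfl fun m _ => ?_
    rw [Finset.sum_range_succ]
    push_cast
    rw [add_sub_cancel_left]
  simp_rw [h2]
  have hi := hmodel.service_indep.precomp (g := ((↑) : Fin k → ℕ)) Fin.val_injective
  have h3 := hi.integral_fun_prod_comp (f := fun (n : Fin k) (s : ℝ≥0) => ∏ m,
      ∫ j, φ n m j ∂poissonMeasure (lam m * (s : ℝ)).toNNReal)
    (fun n => (hmodel.measurable_service n).aemeasurable)
    (fun n => (Finset.measurable_fun_prod _ fun m _ =>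
      measurable_integral_poisson hmodel m (φ n m)).aestronglyMeasurable)
  simp only [Finset.prod_range]
  exact h3

/-- The probability that given numbers of jobs arrive during the services in a finite set. -/
lemma measureReal_arrivalsDuring (hmodel : IsVisitModel P lam b Nb A S)
    [IsProbabilityMeasure P] (s : Finset ℕ) (a : ℕ → Fin M → ℕ) :
    (P.real {ω | ∀ n ∈ s, arrivalsDuring A S n ω = a n} : ℂ) =
      ∏ n ∈ s, ∫ ω, ∏ m, ∫ j, (if j = a n m then (1 : ℂ) else 0)
        ∂poissonMeasure (lam m * (S n ω : ℝ)).toNNReal ∂P := by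
  obtain ⟨k, hk⟩ : ∃ k, s ⊆ Finset.range k := ⟨_, s.subset_range_sup_succ⟩
  -- a product of indicators, with the factor `1` for the services outside `s`
  have h := integral_prod_arrivalsDuring hmodel k
    (fun n m j => if n ∈ s then (if j = a n m then 1 else 0) else 1)
    (fun n m => ⟨1, fun j => by split_ifs <;> simp⟩)
  have hmeas : MeasurableSet {ω | ∀ n ∈ s, arrivalsDuring A S n ω = a n} := by
    simp only [Set.ofPred_forall]
    exact Finset.measurableSet_biInter _ fun n _ =>
      measurable_arrivalsDuring hmodel n (measurableSet_singleton (a n))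
  have hl : ∀ ω, ∏ n ∈ Finset.range k, ∏ m, (if n ∈ s then
      (if arrivalsDuring A S n ω m = a n m then (1 : ℂ) else 0) else 1) =
      {ω | ∀ n ∈ s, arrivalsDuring A S n ω = a n}.indicator (fun _ => (1 : ℂ)) ω := by
    intro ω
    by_cases hω : ∀ n ∈ s, arrivalsDuring A S n ω = a n
    · rw [Set.indicator_of_mem (Set.mem_ofPred_eq ▸ hω)]
      refine Finset.prod_eq_one fun n _ => Finset.prod_eq_one fun m _ => ?_
      split_ifs with h1 h2
      · rfl
      · exact absurd (congrFun (hω n h1) m) h2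
      · rfl
    · rw [Set.indicator_of_notMem (Set.mem_ofPred_eq ▸ hω)]
      push Not at hω
      obtain ⟨n, hn, hne⟩ := hω
      obtain ⟨m, hm⟩ := Function.ne_iff.1 hne
      exact Finset.prod_eq_zero (hk hn) (Finset.prod_eq_zero (Finset.mem_univ m) (by simp [hn, hm]))
  simp_rw [hl] at h
  rw [integral_indicator_const _ hmeas, Complex.real_smul, mul_one] at h
  rw [h, ← Finset.prod_subset hk]
  · refine Finset.prod_congr rfl fun n hn => ?_
    simp only [if_pos hn]
  · intro n _ hn
    simp [hn]

/-- The arrivals during a service are independent of the past of the visit. As all values are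
discrete, it suffices to compare the probabilities of single values. -/
lemma indepFun_past_arrivalsDuring (hmodel : IsVisitModel P lam b Nb A S)
    [IsProbabilityMeasure P] (k : ℕ) :
    IndepFun (fun ω => (Nb ω, fun n : Fin k => arrivalsDuring A S n ω))
      (arrivalsDuring A S k) P := by
  have hX := measurable_arrivalsDuring hmodel
  have hpast : Measurable fun ω => (Nb ω, fun n : Fin k => arrivalsDuring A S n ω) :=
    hmodel.measurable_begin.prodMk (measurable_pi_lambda _ fun n => hX n)
  rw [indepFun_iff_map_prod_eq_prod_map_map hpast.aemeasurable (hX k).aemeasurable]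
  refine Measure.ext_of_singleton ?_
  rintro ⟨⟨i, p⟩, a⟩
  let c : ℕ → Fin M → ℕ := fun n => if h : n < k then p ⟨n, h⟩ else a
  have hN (s : Finset ℕ) : P (Nb ⁻¹' {i} ∩ {ω | ∀ n ∈ s, arrivalsDuring A S n ω = c n}) =
      P (Nb ⁻¹' {i}) * P {ω | ∀ n ∈ s, arrivalsDuring A S n ω = c n} := by
    have hm : MeasurableSet {x : ℕ → Fin M → ℕ | ∀ n ∈ s, x n = c n} := by
      simp only [Set.ofPred_forall]
      exact Finset.measurableSet_biInter _ fun n _ =>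
        (measurable_pi_apply (X := fun _ : ℕ => Fin M → ℕ) n) (measurableSet_singleton (c n))
    exact (indepFun_begin_arrivalsDuring hmodel).measure_inter_preimage_eq_mul _ _
      (measurableSet_singleton i) hm
  -- both sides are products over the services of the probabilities of the single values `c n`
  have hQ : P {ω | ∀ n ∈ Finset.range (k + 1), arrivalsDuring A S n ω = c n} =
      P {ω | ∀ n ∈ Finset.range k, arrivalsDuring A S n ω = c n} *
        P {ω | ∀ n ∈ ({k} : Finset ℕ), arrivalsDuring A S n ω = c n} := by
    have e : P.real {ω | ∀ n ∈ Finset.range (k + 1), arrivalsDuring A S n ω = c n} =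
      P.real {ω | ∀ n ∈ Finset.range k, arrivalsDuring A S n ω = c n} *
        P.real {ω | ∀ n ∈ ({k} : Finset ℕ), arrivalsDuring A S n ω = c n} := by
      apply Complex.ofReal_injective
      rw [Complex.ofReal_mul]
      simp only [measureReal_arrivalsDuring hmodel]
      rw [Finset.prod_range_succ, Finset.prod_singleton]
    rw [← ENNReal.toReal_eq_toReal_iff' (measure_ne_top _ _)
      (ENNReal.mul_ne_top (measure_ne_top _ _) (measure_ne_top _ _)), ENNReal.toReal_mul]
    exact e
  have s1 : (fun ω => ((Nb ω, fun n : Fin k => arrivalsDuring A S n ω),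
      arrivalsDuring A S k ω)) ⁻¹' {((i, p), a)} =
      Nb ⁻¹' {i} ∩ {ω | ∀ n ∈ Finset.range (k + 1), arrivalsDuring A S n ω = c n} := by
    ext ω
    simp only [Set.mem_preimage, Set.mem_singleton_iff, Prod.mk.injEq, Set.mem_inter_iff,
      Set.mem_ofPred_eq, Finset.mem_range, and_assoc, funext_iff (f := fun n : Fin k => _)]
    refine and_congr_right fun _ => ⟨fun h n hn => ?_, fun h => ⟨fun n => ?_, ?_⟩⟩
    · rcases Nat.lt_succ_iff_lt_or_eq.1 hn with h1 | rfl
      · simpa [c, h1] using h.1 ⟨n, h1⟩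
      · simpa [c] using h.2
    · simpa [c] using h n (by omega)
    · simpa [c] using h k (by omega)
  have s2 : (fun ω => (Nb ω, fun n : Fin k => arrivalsDuring A S n ω)) ⁻¹' {(i, p)} =
      Nb ⁻¹' {i} ∩ {ω | ∀ n ∈ Finset.range k, arrivalsDuring A S n ω = c n} := by
    ext ω
    simp only [Set.mem_preimage, Set.mem_singleton_iff, Prod.mk.injEq, Set.mem_inter_iff,
      Set.mem_ofPred_eq, Finset.mem_range, funext_iff (f := fun n : Fin k => _)]
    refine and_congr_right fun _ => ⟨fun h n hn => ?_, fun h n => ?_⟩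
    · simpa [c, hn] using h ⟨n, hn⟩
    · simpa [c] using h n n.2
  have s3 : arrivalsDuring A S k ⁻¹' {a} =
      {ω | ∀ n ∈ ({k} : Finset ℕ), arrivalsDuring A S n ω = c n} := by
    ext ω; simp [c]
  rw [Measure.map_apply (hpast.prodMk (hX k)) (measurableSet_singleton _), s1,
    ← Set.singleton_prod_singleton, Measure.prod_prod,
    Measure.map_apply hpast (measurableSet_singleton _), s2,
    Measure.map_apply (hX k) (measurableSet_singleton _), s3, hN, hN, hQ, mul_assoc]

end Model

/-! ### Arrivals during an exponential service -/

lemma integrableOn_pow_mul_cexp (n : ℕ) {c : ℂ} (hc : 0 < c.re) :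
    IntegrableOn (fun t : ℝ => (t : ℂ) ^ n * Complex.exp (-c * t)) (Set.Ioi 0) := by
  have h := integrableOn_rpow_mul_exp_neg_mul_rpow (p := 1) (s := n)
    (by have : (0 : ℝ) ≤ n := n.cast_nonneg
        linarith) one_pos hc
  refine Integrable.mono' h (by fun_prop) ?_
  filter_upwards [ae_restrict_mem measurableSet_Ioi] with t ht
  rw [norm_mul, norm_pow, Complex.norm_exp, Complex.norm_real,
    Real.norm_of_nonneg (le_of_lt ht)]
  simp

/-- The moments of a complex exponential density. -/
lemma integral_pow_mul_cexp (n : ℕ) {c : ℂ} (hc : 0 < c.re) :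
    ∫ t in Set.Ioi (0 : ℝ), (t : ℂ) ^ n * Complex.exp (-c * t) = n.factorial / c ^ (n + 1) := by
  have hc0 : c ≠ 0 := fun h => by simp [h] at hc
  induction n with
  | zero =>
    simp only [pow_zero, one_mul]
    rw [integral_exp_mul_complex_Ioi (by simpa using hc)]
    simp
  | succ n ih =>
    have hder : ∀ t ∈ Set.Ioi (0 : ℝ),
        HasDerivAt (fun t : ℝ => (t : ℂ) ^ (n + 1) * Complex.exp (-c * t))
          ((n + 1 : ℂ) * ((t : ℂ) ^ n * Complex.exp (-c * t))
            - c * ((t : ℂ) ^ (n + 1) * Complex.exp (-c * t))) t := by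
      intro t _
      have h1 : HasDerivAt (fun t : ℝ => (t : ℂ)) 1 t := Complex.ofRealCLM.hasDerivAt
      have h2 := (h1.pow (n + 1)).mul ((h1.const_mul (-c)).cexp)
      refine h2.congr_deriv ?_
      simp only [Pi.pow_apply]
      push_cast
      ring
    have hlim : Filter.Tendsto (fun t : ℝ => (t : ℂ) ^ (n + 1) * Complex.exp (-c * t))
        Filter.atTop (nhds 0) := by
      rw [tendsto_zero_iff_norm_tendsto_zero]
      refine (tendsto_rpow_mul_exp_neg_mul_atTop_nhds_zero (n + 1 : ℕ) c.re hc).congr' ?_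
      filter_upwards [Filter.eventually_ge_atTop 0] with t ht
      rw [norm_mul, norm_pow, Complex.norm_exp, Complex.norm_real, Real.norm_of_nonneg ht,
        Real.rpow_natCast]
      simp
    have hi := (integrableOn_pow_mul_cexp n hc).const_mul (n + 1 : ℂ)
    have hi' := (integrableOn_pow_mul_cexp (n + 1) hc).const_mul c
    have h := integral_Ioi_of_hasDerivAt_of_tendsto (a := (0 : ℝ))
      (Continuous.continuousWithinAt (by fun_prop)) hder (hi.sub hi') hlim
    rw [integral_sub hi hi', integral_const_mul, integral_const_mul, ih] at h
    simp only [Complex.ofReal_zero, ne_eq, Nat.add_eq_zero_iff, one_ne_zero, and_false,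
      not_false_eq_true, zero_pow, zero_mul, sub_zero] at h
    rw [eq_div_iff (pow_ne_zero _ hc0), Nat.factorial_succ]
    push_cast
    have hp : c ^ (n + 1) ≠ 0 := pow_ne_zero _ hc0
    field_simp at h
    rw [pow_succ]
    simp only [neg_mul] at h ⊢
    linear_combination -h

lemma integral_expMeasure {r : ℝ} (hr : 0 < r) (f : ℝ → ℂ) :
    ∫ t, f t ∂expMeasure r = ∫ t in Set.Ioi (0 : ℝ), (r * Real.exp (-(r * t)) : ℝ) * f t := by
  have hm : Measurable (gammaPDF 1 r) := (measurable_gammaPDFReal 1 r).ennreal_ofReal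
  rw [expMeasure, gammaMeasure, integral_withDensity_eq_integral_toReal_smul hm
    (Filter.Eventually.of_forall fun t => ENNReal.ofReal_lt_top), ← integral_Ici_eq_integral_Ioi,
    ← integral_indicator measurableSet_Ici]
  refine integral_congr_ae (Filter.Eventually.of_forall fun t => ?_)
  by_cases ht : 0 ≤ t
  · simp only [gammaPDF_of_nonneg ht, Set.indicator_of_mem (Set.mem_Ici.2 ht)]
    rw [ENNReal.toReal_ofReal (by simp; positivity)]
    simp
  · simp [gammaPDF_of_neg (not_le.1 ht), ht]

lemma integral_poissonMeasure_pow (r : ℝ≥0) (v : ℂ) :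
    ∫ j, v ^ j ∂poissonMeasure r = Complex.exp (-(r * (1 - v))) := by
  rw [integral_poissonMeasure]
  have h := ((NormedSpace.expSeries_div_hasSum_exp ((r : ℂ) * v)).mul_left
    (Complex.exp (-r))).tsum_eq
  rw [← Complex.exp_eq_exp_ℂ, ← Complex.exp_add] at h
  rw [show -((r : ℂ) * (1 - v)) = -r + r * v by ring, ← h]
  refine tsum_congr fun j => ?_
  rw [Complex.real_smul]
  push_cast
  ring

section Parameters

variable {M : ℕ} {lam : Fin M → ℝ} {b : ℝ} {q : Fin M} {z : Fin M → ℂ}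

lemma otherRate_re_nonneg (hlam : ∀ m, 0 < lam m) (hz : ∀ m, ‖z m‖ ≤ 1) :
    0 ≤ (otherRate lam q z).re := by
  rw [otherRate, Complex.re_sum]
  refine Finset.sum_nonneg fun m _ => ?_
  have := (Complex.re_le_norm (z m)).trans (hz m)
  simpa using mul_nonneg (hlam m).le (sub_nonneg.2 this)

lemma lam_mul_xParam (hlam : ∀ m, 0 < lam m) :
    (lam q : ℂ) * xParam lam b q z = lam q + otherRate lam q z + 1 / b := by
  have : (lam q : ℂ) ≠ 0 := by exact_mod_cast (hlam q).ne'
  rw [xParam]; field_simp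

lemma le_re_xParam (hlam : ∀ m, 0 < lam m) (hz : ∀ m, ‖z m‖ ≤ 1) :
    1 + 1 / (lam q * b) ≤ (xParam lam b q z).re := by
  have h : xParam lam b q z =
      ((lam q + (otherRate lam q z).re + 1 / b) / lam q : ℝ) +
        ((otherRate lam q z).im / lam q : ℝ) * Complex.I := by
    rw [xParam]
    conv_lhs => rw [← Complex.re_add_im (otherRate lam q z)]
    push_cast
    ring
  rw [h]
  simp only [Complex.add_re, Complex.ofReal_re, Complex.re_ofReal_mul, Complex.I_re, mul_zero,
    add_zero]
  rw [le_div_iff₀ (hlam q)]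
  have := otherRate_re_nonneg (q := q) hlam hz
  have h1 : 1 / (lam q * b) * lam q = 1 / b := by
    have := (hlam q).ne'
    field_simp
  rw [add_mul, h1]
  linarith

lemma one_lt_norm_xParam (hlam : ∀ m, 0 < lam m) (hb : 0 < b) (hz : ∀ m, ‖z m‖ ≤ 1) :
    1 < ‖xParam lam b q z‖ := by
  have h := (le_re_xParam (b := b) (q := q) hlam hz).trans (Complex.re_le_norm _)
  have : 0 < 1 / (lam q * b) := by have := hlam q; positivity
  linarith

end Parameters

section Model

variable {Ω : Type*} [MeasurableSpace Ω] {P : Measure Ω} {M : ℕ} {lam : Fin M → ℝ} {b : ℝ}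
  {Nb : Ω → Fin M → ℕ} {A : Fin M → ℝ≥0 → Ω → ℕ} {S : ℕ → Ω → ℝ≥0}

/-- `E[e^{-σ S}; j arrivals at queue q during S]` for a service requirement `S`. -/
lemma integral_service_weight (hmodel : IsVisitModel P lam b Nb A S) (hlam : ∀ m, 0 < lam m)
    (hb : 0 < b) (q : Fin M) {z : Fin M → ℂ} (hz : ∀ m, ‖z m‖ ≤ 1) (n j : ℕ) :
    ∫ ω, Complex.exp (-(otherRate lam q z * (S n ω : ℝ))) *
      ((Real.exp (-(lam q * (S n ω : ℝ))) * (lam q * (S n ω : ℝ)) ^ j / j.factorial : ℝ) : ℂ) ∂P =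
      1 / (lam q * b) / xParam lam b q z ^ (j + 1) := by
  set σ := otherRate lam q z with hσ
  have hl : (lam q : ℂ) ≠ 0 := by exact_mod_cast (hlam q).ne'
  have hb0 : (b : ℂ) ≠ 0 := by exact_mod_cast hb.ne'
  have hx0 : xParam lam b q z ≠ 0 :=
    norm_pos_iff.1 (zero_lt_one.trans (one_lt_norm_xParam hlam hb hz))
  have hlaw := (hmodel.service_law n).integral_comp (f := fun t : ℝ => Complex.exp (-(σ * t)) *
    ((Real.exp (-(lam q * t)) * (lam q * t) ^ j / j.factorial : ℝ) : ℂ)) (by fun_prop)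
  refine hlaw.trans ?_
  rw [integral_expMeasure (by positivity)]
  have hre : 0 < ((lam q : ℂ) * xParam lam b q z).re := by
    have h1 := le_re_xParam (b := b) (q := q) hlam hz
    have h2 := hlam q
    have h3 : 0 < 1 / (lam q * b) := by positivity
    rw [Complex.re_ofReal_mul]
    exact mul_pos h2 (by linarith)
  have h : ∀ t : ℝ, ((1 / b * Real.exp (-(1 / b * t)) : ℝ) : ℂ) * (Complex.exp (-(σ * t)) *
      ((Real.exp (-(lam q * t)) * (lam q * t) ^ j / j.factorial : ℝ) : ℂ)) =
      (1 / b * (lam q : ℂ) ^ j / j.factorial) *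
        ((t : ℂ) ^ j * Complex.exp (-(lam q * xParam lam b q z) * t)) := by
    intro t
    rw [lam_mul_xParam hlam, ← hσ,
      show -((lam q : ℂ) + σ + 1 / b) * t = -(1 / b * t) + (-(σ * t) + -(lam q * t)) by ring,
      Complex.exp_add, Complex.exp_add]
    push_cast
    ring
  simp_rw [h]
  rw [integral_const_mul, integral_pow_mul_cexp j hre, mul_pow]
  have hj : (j.factorial : ℂ) ≠ 0 := by exact_mod_cast j.factorial_ne_zero
  field_simp
  ring

/-- The arrivals during one service: the generating function at the queues other than `q`,
jointly with an arbitrary bounded function of the number of arrivals at queue `q`. -/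
lemma integral_arrivalsDuring (hmodel : IsVisitModel P lam b Nb A S) [IsProbabilityMeasure P]
    (hlam : ∀ m, 0 < lam m) (hb : 0 < b) (q : Fin M) {z : Fin M → ℂ} (hz : ∀ m, ‖z m‖ ≤ 1)
    (n : ℕ) {f : ℕ → ℂ} {C : ℝ} (hf : ∀ j, ‖f j‖ ≤ C) :
    ∫ ω, (∏ m ∈ Finset.univ.erase q, z m ^ arrivalsDuring A S n ω m) *
        f (arrivalsDuring A S n ω q) ∂P =
      ∑' j, 1 / (lam q * b) / xParam lam b q z ^ (j + 1) * f j := by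
  have h0 := integral_prod_arrivalsDuring hmodel (n + 1)
    (fun n' m j => if n' = n then (if m = q then f j else z m ^ j) else 1)
    (fun n' m => by
      by_cases h1 : n' = n
      · by_cases h2 : m = q
        · exact ⟨C, fun j => by simpa [h1, h2] using hf j⟩
        · exact ⟨1, fun j => by
            simpa [h1, h2] using pow_le_one₀ (norm_nonneg (z m)) (hz m)⟩
      · exact ⟨1, fun j => by simp [h1]⟩)
  rw [Finset.prod_eq_single n (fun n' _ hn => by simp [hn]) (fun h => by simp at h)] at h0
  have hL : ∀ ω, ∏ n' ∈ Finset.range (n + 1), ∏ m, (if n' = n then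
      (if m = q then f (arrivalsDuring A S n' ω m) else z m ^ arrivalsDuring A S n' ω m)
        else (1 : ℂ)) =
      (∏ m ∈ Finset.univ.erase q, z m ^ arrivalsDuring A S n ω m) *
        f (arrivalsDuring A S n ω q) := by
    intro ω
    rw [Finset.prod_eq_single n (fun n' _ hn => by simp [hn]) (fun h => by simp at h),
      ← Finset.mul_prod_erase _ _ (Finset.mem_univ q), mul_comm]
    simp only [if_true]
    congr 1
    exact Finset.prod_congr rfl fun m hm => by rw [if_neg (Finset.ne_of_mem_erase hm)]
  simp_rw [hL, if_true] at h0
  rw [h0]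
  have hR : ∀ ω, ∏ m, ∫ j, (if m = q then f j else z m ^ j)
        ∂poissonMeasure (lam m * (S n ω : ℝ)).toNNReal =
      Complex.exp (-(otherRate lam q z * (S n ω : ℝ))) *
        ∫ j, f j ∂poissonMeasure (lam q * (S n ω : ℝ)).toNNReal := by
    intro ω
    rw [← Finset.mul_prod_erase _ _ (Finset.mem_univ q), mul_comm]
    simp only [if_true]
    congr 1
    rw [otherRate, Finset.sum_mul, ← Finset.sum_neg_distrib, Complex.exp_sum]
    refine Finset.prod_congr rfl fun m hm => ?_
    simp only [if_neg (Finset.ne_of_mem_erase hm)]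
    rw [integral_poissonMeasure_pow]
    have : (((lam m * (S n ω : ℝ)).toNNReal : ℝ≥0) : ℂ) = (lam m : ℂ) * (S n ω : ℝ) := by
      rw [← Complex.ofReal_mul, ← Real.coe_toNNReal (lam m * (S n ω : ℝ))
        (mul_nonneg (hlam m).le (S n ω).coe_nonneg)]
      simp
    rw [this]
    ring_nf
  simp_rw [hR]
  have hpos (ω : Ω) : 0 ≤ lam q * (S n ω : ℝ) := mul_nonneg (hlam q).le (S n ω).coe_nonneg
  -- the Poisson weights, which sum up to `1`
  set p : ℕ → Ω → ℝ := fun j ω =>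
    Real.exp (-(lam q * (S n ω : ℝ))) * (lam q * (S n ω : ℝ)) ^ j / j.factorial with hp
  have hpsum (ω : Ω) : HasSum (fun j => p j ω) 1 := by
    have := hasSum_one_poissonMeasure (lam q * (S n ω : ℝ)).toNNReal
    rwa [Real.coe_toNNReal _ (hpos ω)] at this
  have hp0 (j : ℕ) (ω : Ω) : 0 ≤ p j ω := by
    have := hpos ω
    simp only [hp]; positivity
  have hexp (ω : Ω) : ‖Complex.exp (-(otherRate lam q z * (S n ω : ℝ)))‖ ≤ 1 := by
    rw [Complex.norm_exp, Real.exp_le_one_iff, Complex.neg_re, Complex.re_mul_ofReal]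
    exact neg_nonpos.2 (mul_nonneg (otherRate_re_nonneg hlam hz) (S n ω).coe_nonneg)
  have hS : Measurable fun ω => (S n ω : ℝ) := (hmodel.measurable_service n).coe_nnreal_real
  have hbd (j : ℕ) (ω : Ω) : ‖(p j ω : ℂ) * f j‖ ≤ p j ω * C := by
    rw [norm_mul, Complex.norm_real, Real.norm_of_nonneg (hp0 j ω)]
    exact mul_le_mul_of_nonneg_left (hf j) (hp0 j ω)
  have key := hasSum_integral_of_dominated_convergence (μ := P)
    (F := fun j ω => Complex.exp (-(otherRate lam q z * (S n ω : ℝ))) * ((p j ω : ℂ) * f j))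
    (f := fun ω => Complex.exp (-(otherRate lam q z * (S n ω : ℝ))) *
        ∫ j, f j ∂poissonMeasure (lam q * (S n ω : ℝ)).toNNReal)
    (fun j ω => p j ω * C) (fun j => by
      simp only [hp]
      exact Measurable.aestronglyMeasurable (by fun_prop))
    (fun j => Filter.Eventually.of_forall fun ω => by
      rw [norm_mul]
      exact (mul_le_of_le_one_left (norm_nonneg _) (hexp ω)).trans (hbd j ω))
    (Filter.Eventually.of_forall fun ω => ((hpsum ω).mul_right C).summable)
    (by
      have : (fun ω => ∑' j, p j ω * C) = fun _ => 1 * C := by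
        ext ω; exact ((hpsum ω).mul_right C).tsum_eq
      rw [this]
      exact integrable_const _)
    (Filter.Eventually.of_forall fun ω => by
      refine HasSum.mul_left _ ?_
      rw [integral_poissonMeasure]
      simp only [Real.coe_toNNReal _ (hpos ω), Complex.real_smul]
      exact (Summable.of_norm_bounded ((hpsum ω).mul_right C).summable
        fun j => hbd j ω).hasSum)
  rw [← key.tsum_eq]
  refine tsum_congr fun j => ?_
  simp_rw [← mul_assoc]
  rw [integral_mul_const, integral_service_weight hmodel hlam hb q hz n j]

end Model

/-! ### The queue lengths as a stopped Markov chain -/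

/-- The state after one more potential service of queue `q`, if `y` is the present state and `a`
the vector of arrivals during the service; nothing changes once queue `q` is empty. -/
def stepState {M : ℕ} (q : Fin M) (y a : Fin M → ℕ) : Fin M → ℕ :=
  if y q = 0 then y else fun m => y m + a m - (if m = q then 1 else 0)

lemma monom_eq_prod_erase_mul {M : ℕ} (z : Fin M → ℂ) (q : Fin M) (n : Fin M → ℕ) :
    monom z n = (∏ m ∈ Finset.univ.erase q, z m ^ n m) * z q ^ n q :=
  (Finset.prod_erase_mul _ _ (Finset.mem_univ q)).symm

lemma norm_prod_pow_le_one {M : ℕ} {z : Fin M → ℂ} (hz : ∀ m, ‖z m‖ ≤ 1) (s : Finset (Fin M))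
    (n : Fin M → ℕ) : ‖∏ m ∈ s, z m ^ n m‖ ≤ 1 := by
  rw [norm_prod]
  refine Finset.prod_le_one (fun _ _ => norm_nonneg _) fun m _ => ?_
  rw [norm_pow]
  exact pow_le_one₀ (norm_nonneg _) (hz m)

section Model

variable {Ω : Type*} [MeasurableSpace Ω] {P : Measure Ω} {M : ℕ} {lam : Fin M → ℝ} {b : ℝ}
  {Nb : Ω → Fin M → ℕ} {A : Fin M → ℝ≥0 → Ω → ℕ} {S : ℕ → Ω → ℝ≥0}

lemma queuesAfter_zero (hmodel : IsVisitModel P lam b Nb A S) (q : Fin M) (ω : Ω) :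
    queuesAfter Nb A S q 0 ω = Nb ω := by
  ext m
  simp [queuesAfter, departureTime, (hmodel.poisson m).zero]

/-- While queue `q` is not empty the truncated subtraction in `queuesAfter` is exact. -/
lemma queuesAfter_succ (hmodel : IsVisitModel P lam b Nb A S) (q : Fin M) (k : ℕ) (ω : Ω)
    (h : queuesAfter Nb A S q k ω q ≠ 0) :
    queuesAfter Nb A S q (k + 1) ω =
      stepState q (queuesAfter Nb A S q k ω) (arrivalsDuring A S k ω) := by
  rw [stepState, if_neg h]
  ext m
  have hmono : A m (departureTime S k ω) ω ≤ A m (departureTime S (k + 1) ω) ω := by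
    refine (hmodel.poisson m).mono ω ?_
    rw [departureTime, departureTime, Finset.sum_range_succ]
    exact le_self_add
  by_cases hm : m = q
  · subst hm
    simp only [queuesAfter, arrivalsDuring, if_true] at h ⊢
    omega
  · simp only [queuesAfter, arrivalsDuring, if_neg hm]
    omega

lemma endState_zero (hmodel : IsVisitModel P lam b Nb A S) (q : Fin M) (ω : Ω) :
    endState Nb A S q 0 ω = Nb ω := by
  have h : servedJobs Nb A S q 0 ω = 0 := Nat.le_zero.1 (Nat.sInf_le (Or.inl rfl))
  rw [endState, h, queuesAfter_zero hmodel]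

lemma endState_succ (hmodel : IsVisitModel P lam b Nb A S) (q : Fin M) (k : ℕ) (ω : Ω) :
    endState Nb A S q (k + 1) ω =
      stepState q (endState Nb A S q k ω) (arrivalsDuring A S k ω) := by
  have hle (k n : ℕ) (h : n = k ∨ queuesAfter Nb A S q n ω q = 0) :
      servedJobs Nb A S q k ω ≤ n := Nat.sInf_le h
  have hmem (k : ℕ) : servedJobs Nb A S q k ω = k ∨
      queuesAfter Nb A S q (servedJobs Nb A S q k ω) ω q = 0 :=
    Nat.sInf_mem (s := {n : ℕ | n = k ∨ queuesAfter Nb A S q n ω q = 0}) ⟨k, Or.inl rfl⟩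
  have hk := hle k k (Or.inl rfl)
  have hk1 := hle (k + 1) (k + 1) (Or.inl rfl)
  by_cases h : endState Nb A S q k ω q = 0
  · rw [stepState, if_pos h]
    have : servedJobs Nb A S q (k + 1) ω = servedJobs Nb A S q k ω := by
      refine le_antisymm (hle _ _ (Or.inr h)) ?_
      rcases hmem (k + 1) with h1 | h1
      · omega
      · exact hle _ _ (Or.inr h1)
    rw [endState, this, endState]
  · have hs : servedJobs Nb A S q k ω = k := (hmem k).resolve_right h
    have h' : queuesAfter Nb A S q k ω q ≠ 0 := by rwa [endState, hs] at h
    have hs1 : servedJobs Nb A S q (k + 1) ω = k + 1 := by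
      rcases hmem (k + 1) with h1 | h1
      · exact h1
      · have h2 := hle k _ (Or.inr h1)
        have h3 : servedJobs Nb A S q (k + 1) ω ≠ k := fun h3 => h' (h3 ▸ h1)
        omega
    rw [endState, hs1, queuesAfter_succ hmodel q k ω h', endState, hs]

/-- The state at the end of the visit is a function of the initial state and of the arrivals
during the first `k` services. -/
lemma exists_endState_eq (hmodel : IsVisitModel P lam b Nb A S) (q : Fin M) (k : ℕ) :
    ∃ F : (Fin M → ℕ) × (Fin k → Fin M → ℕ) → Fin M → ℕ,
      ∀ ω, endState Nb A S q k ω = F (Nb ω, fun n => arrivalsDuring A S n ω) := by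
  induction k with
  | zero => exact ⟨Prod.fst, fun ω => endState_zero hmodel q ω⟩
  | succ k ih =>
    obtain ⟨F, hF⟩ := ih
    refine ⟨fun p => stepState q (F (p.1, fun n => p.2 n.castSucc)) (p.2 (Fin.last k)),
      fun ω => ?_⟩
    rw [endState_succ hmodel, hF]
    simp

lemma indepFun_endState_arrivalsDuring (hmodel : IsVisitModel P lam b Nb A S)
    [IsProbabilityMeasure P] (q : Fin M) (k : ℕ) :
    IndepFun (fun ω => (Nb ω, endState Nb A S q k ω)) (arrivalsDuring A S k) P := by
  obtain ⟨F, hF⟩ := exists_endState_eq hmodel q k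
  have := (indepFun_past_arrivalsDuring hmodel k).comp (φ := fun p => (p.1, F p)) (ψ := fun a => a)
    .of_discrete measurable_id'
  simpa only [Function.comp_def, hF] using this

lemma measurable_endState (hmodel : IsVisitModel P lam b Nb A S) (q : Fin M) (k : ℕ) :
    Measurable (endState Nb A S q k) := by
  obtain ⟨F, hF⟩ := exists_endState_eq hmodel q k
  rw [funext hF]
  exact Measurable.of_discrete.comp (hmodel.measurable_begin.prodMk
    (measurable_pi_lambda _ fun n => measurable_arrivalsDuring hmodel n))

lemma integrable_comp_of_bound [IsProbabilityMeasure P] {N : Ω → Fin M → ℕ} (hN : Measurable N)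
    {g : (Fin M → ℕ) → ℂ} {C : ℝ} (hg : ∀ n, ‖g n‖ ≤ C) : Integrable (fun ω => g (N ω)) P :=
  Integrable.of_bound ((Measurable.of_discrete (f := g)).comp hN).aestronglyMeasurable C
    (Filter.Eventually.of_forall fun _ => hg _)

/-- The queue lengths at the end of a visit: the successive services act on the length of the
visited queue through the powers of `serviceOp`, whatever function `h` of the initial state is
observed with them. -/
lemma integral_endState (hmodel : IsVisitModel P lam b Nb A S) [IsProbabilityMeasure P]
    (hlam : ∀ m, 0 < lam m) (hb : 0 < b) (q : Fin M) {z : Fin M → ℂ} (hz : ∀ m, ‖z m‖ ≤ 1)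
    {h : (Fin M → ℕ) → ℂ} (hh : ∀ n, ‖h n‖ ≤ 1) (k : ℕ) {f : ℕ → ℂ}
    (hf : ∃ C, ∀ a, ‖f a‖ ≤ C) :
    ∫ ω, h (Nb ω) * ((∏ m ∈ Finset.univ.erase q, z m ^ endState Nb A S q k ω m) *
        f (endState Nb A S q k ω q)) ∂P =
      ∫ ω, h (Nb ω) * ((∏ m ∈ Finset.univ.erase q, z m ^ Nb ω m) *
        (serviceOp (1 / (lam q * b)) (xParam lam b q z))^[k] f (Nb ω q)) ∂P := by
  have hx := one_lt_norm_xParam (q := q) hlam hb hz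
  induction k generalizing f with
  | zero => simp only [endState_zero hmodel, Function.iterate_zero, id]
  | succ k ih =>
    rw [Function.iterate_succ]
    refine Eq.trans ?_ (ih (exists_bound_serviceOp hx hf))
    obtain ⟨C, hC⟩ := hf
    -- average first over the arrivals during the last service
    have hfub := integral_comp_of_indepFun
      (hmodel.measurable_begin.prodMk (measurable_endState hmodel q k))
      (measurable_arrivalsDuring hmodel k) (indepFun_endState_arrivalsDuring hmodel q k)
      (g := fun p : ((Fin M → ℕ) × (Fin M → ℕ)) × (Fin M → ℕ) =>
        h p.1.1 * ((∏ m ∈ Finset.univ.erase q, z m ^ stepState q p.1.2 p.2 m) *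
          f (stepState q p.1.2 p.2 q)))
      .of_discrete (C := 1 * (1 * C)) (fun p => by
        rw [norm_mul, norm_mul]
        exact mul_le_mul (hh _) (mul_le_mul (norm_prod_pow_le_one hz _ _) (hC _)
          (norm_nonneg _) zero_le_one) (by positivity) zero_le_one)
    simp only [endState_succ hmodel]
    refine hfub.trans (integral_congr_ae (Filter.Eventually.of_forall fun ω => ?_))
    simp only
    rw [integral_const_mul]
    congr 1
    generalize endState Nb A S q k ω = y
    by_cases hy : y q = 0
    · simp [stepState, hy, serviceOp]
    · have hq (a : Fin M → ℕ) : (∏ m ∈ Finset.univ.erase q, z m ^ stepState q y a m) *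
          f (stepState q y a q) = (∏ m ∈ Finset.univ.erase q, z m ^ y m) *
            ((∏ m ∈ Finset.univ.erase q, z m ^ a m) * f (y q - 1 + a q)) := by
        rw [← mul_assoc, ← Finset.prod_mul_distrib]
        congr 1
        · refine Finset.prod_congr rfl fun m hm => ?_
          rw [stepState, if_neg hy, ← pow_add]
          simp [Finset.ne_of_mem_erase hm]
        · rw [stepState, if_neg hy]
          congr 1
          simp only [if_true]
          omega
      simp_rw [hq]
      rw [integral_const_mul, integral_arrivalsDuring hmodel hlam hb q hz k
        (f := fun j => f (y q - 1 + j)) (fun j => hC _), serviceOp, if_neg hy]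

lemma pgf_endState (hmodel : IsVisitModel P lam b Nb A S) [IsProbabilityMeasure P]
    (hlam : ∀ m, 0 < lam m) (hb : 0 < b) (q : Fin M) {z : Fin M → ℂ} (hz : ∀ m, ‖z m‖ ≤ 1)
    (k : ℕ) :
    pgf P (endState Nb A S q k) z = ∫ ω, (∏ m ∈ Finset.univ.erase q, z m ^ Nb ω m) *
      (serviceOp (1 / (lam q * b)) (xParam lam b q z))^[k] (fun a => z q ^ a) (Nb ω q) ∂P := by
  have h := integral_endState hmodel hlam hb q hz (h := fun _ => 1) (by simp) k
    (exists_bound_pow (hz q))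
  simp only [one_mul] at h
  rw [← h, pgf]
  simp only [monom_eq_prod_erase_mul z q]

lemma condPgf_endState (hmodel : IsVisitModel P lam b Nb A S) [IsProbabilityMeasure P]
    (hlam : ∀ m, 0 < lam m) (hb : 0 < b) (q : Fin M) {z : Fin M → ℂ} (hz : ∀ m, ‖z m‖ ≤ 1)
    (k : ℕ) {i : Fin M → ℕ} (hi : P (Nb ⁻¹' {i}) ≠ 0) :
    condPgf P (endState Nb A S q k) Nb i z = (∏ m ∈ Finset.univ.erase q, z m ^ i m) *
      (serviceOp (1 / (lam q * b)) (xParam lam b q z))^[k] (fun a => z q ^ a) (i q) := by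
  have h := integral_endState hmodel hlam hb q hz (h := fun n => if n = i then 1 else 0)
    (fun n => by split_ifs <;> simp) k (exists_bound_pow (hz q))
  have hm : MeasurableSet (Nb ⁻¹' {i}) := hmodel.measurable_begin (measurableSet_singleton i)
  have hL : ∀ ω, (if Nb ω = i then (1 : ℂ) else 0) *
      ((∏ m ∈ Finset.univ.erase q, z m ^ endState Nb A S q k ω m) *
        z q ^ endState Nb A S q k ω q) =
      (Nb ⁻¹' {i}).indicator (fun ω => monom z (endState Nb A S q k ω)) ω := by
    intro ω
    rw [← monom_eq_prod_erase_mul]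
    by_cases hω : Nb ω = i
    · simp [hω]
    · simp [hω]
  have hR : ∀ ω, (if Nb ω = i then (1 : ℂ) else 0) *
      ((∏ m ∈ Finset.univ.erase q, z m ^ Nb ω m) *
        (serviceOp (1 / (lam q * b)) (xParam lam b q z))^[k] (fun a => z q ^ a) (Nb ω q)) =
      (Nb ⁻¹' {i}).indicator (fun _ => (∏ m ∈ Finset.univ.erase q, z m ^ i m) *
        (serviceOp (1 / (lam q * b)) (xParam lam b q z))^[k] (fun a => z q ^ a) (i q)) ω := by
    intro ω
    by_cases hω : Nb ω = i
    · simp [hω]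
    · simp [hω]
  simp_rw [hL, hR] at h
  rw [integral_indicator hm, integral_indicator_const _ hm] at h
  rw [condPgf, pgf, ProbabilityTheory.cond, integral_smul_measure, h, smul_smul,
    ENNReal.toReal_inv, measureReal_def, inv_mul_cancel₀, one_smul]
  exact ENNReal.toReal_ne_zero.2 ⟨hi, measure_ne_top _ _⟩

end Model

/-! ### Roots in the unit disc -/

section Roots

variable {M : ℕ} {lam : Fin M → ℝ} {b : ℝ} {q : Fin M} {z : Fin M → ℂ}

lemma isUnitDiscRoot_iff (hlam : ∀ m, 0 < lam m) (hb : 0 < b) (y : ℂ) :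
    IsUnitDiscRoot lam b q z y ↔
      ‖y‖ ≤ 1 ∧ (1 / (lam q * b) : ℂ) = y * (xParam lam b q z - y) := by
  have hl : (lam q : ℂ) ≠ 0 := by exact_mod_cast (hlam q).ne'
  have hb0 : (b : ℂ) ≠ 0 := by exact_mod_cast hb.ne'
  refine and_congr_right fun _ => ?_
  have h : (lam q : ℂ) * y ^ 2 - ((lam q : ℂ) + 1 / (b : ℂ) + otherRate lam q z) * y + 1 / (b : ℂ) =
      lam q * (1 / (lam q * b) - y * (xParam lam b q z - y)) := by
    have h1 : (lam q : ℂ) * (1 / (lam q * b)) = 1 / b := by field_simp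
    linear_combination y * lam_mul_xParam (b := b) (q := q) (z := z) hlam - h1
  rw [h, mul_eq_zero, or_iff_right hl, sub_eq_zero]

/-- The product `1 / (lam q * b)` and the sum `x` of the two roots satisfy
`1 + 1 / (lam q * b) ≤ re x`, so that not both roots can lie outside the closed unit disc. -/
lemma exists_isUnitDiscRoot (hlam : ∀ m, 0 < lam m) (hb : 0 < b) (hz : ∀ m, ‖z m‖ ≤ 1) :
    ∃ y, IsUnitDiscRoot lam b q z y := by
  simp only [isUnitDiscRoot_iff hlam hb]
  set x := xParam lam b q z with hx
  obtain ⟨s, hs⟩ := IsAlgClosed.exists_pow_nat_eq (x ^ 2 - 4 * (1 / (lam q * b) : ℂ)) two_pos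
  have hprod : (1 / (lam q * b) : ℂ) = ((x + s) / 2) * ((x - s) / 2) := by
    linear_combination (1 / 4 : ℂ) * hs
  by_contra! hcon
  have h1 : 1 < ‖(x + s) / 2‖ := by
    by_contra! h
    exact hcon _ h (by rw [hprod]; ring)
  have h2 : 1 < ‖(x - s) / 2‖ := by
    by_contra! h
    exact hcon _ h (by rw [hprod]; ring)
  have hn : 1 / (lam q * b) = ‖(x + s) / 2‖ * ‖(x - s) / 2‖ := by
    have h0 : 0 < 1 / (lam q * b) := by have := hlam q; positivity
    rw [← norm_mul, ← hprod, ← Real.norm_of_nonneg h0.le, ← Complex.norm_real]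
    push_cast
    rfl
  have hre : x.re ≤ ‖(x + s) / 2‖ + ‖(x - s) / 2‖ :=
    calc x.re ≤ ‖x‖ := Complex.re_le_norm x
      _ = ‖(x + s) / 2 + (x - s) / 2‖ := by congr 1; ring
      _ ≤ _ := norm_add_le _ _
  have := le_re_xParam (b := b) (q := q) hlam hz
  nlinarith [mul_pos (sub_pos.2 h1) (sub_pos.2 h2)]

lemma existsUnique_isUnitDiscRoot (hlam : ∀ m, 0 < lam m) (hb : 0 < b) (hz : ∀ m, ‖z m‖ ≤ 1)
    (hq : lam q * b < 1) : ∃! y, IsUnitDiscRoot lam b q z y := by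
  obtain ⟨y, hy⟩ := exists_isUnitDiscRoot (q := q) hlam hb hz
  refine ⟨y, hy, fun y' hy' => ?_⟩
  obtain ⟨hy1, hy2⟩ := (isUnitDiscRoot_iff hlam hb y).1 hy
  obtain ⟨hy1', hy2'⟩ := (isUnitDiscRoot_iff hlam hb y').1 hy'
  by_contra hne
  -- two different roots would have the product `1 / (lam q * b)`, which exceeds `1`
  have hsum : xParam lam b q z - y = y' := by
    refine mul_left_cancel₀ (sub_ne_zero.2 hne) ?_
    linear_combination hy2 - hy2'
  rw [hsum] at hy2
  have hn : 1 / (lam q * b) = ‖y‖ * ‖y'‖ := by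
    have h0 : 0 < 1 / (lam q * b) := by have := hlam q; positivity
    rw [← norm_mul, ← hy2, ← Real.norm_of_nonneg h0.le, ← Complex.norm_real]
    push_cast
    rfl
  have h1 : 1 < 1 / (lam q * b) := by
    rw [lt_div_iff₀ (mul_pos (hlam q) hb)]; linarith
  have h2 : ‖y‖ * ‖y'‖ ≤ 1 := mul_le_one₀ hy1 (norm_nonneg _) hy1'
  linarith

end Roots

/-! ### The transforms in terms of `serviceOp` -/

section Formulas

variable {M : ℕ} {lam : Fin M → ℝ} {b : ℝ} {q : Fin M} {z : Fin M → ℂ}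

lemma seriesS_eq (hlam : ∀ m, 0 < lam m) (hb : 0 < b) (hz : ∀ m, ‖z m‖ ≤ 1) {y : ℂ}
    (hy : IsUnitDiscRoot lam b q z y) {k i : ℕ} (hk : 2 ≤ k) (hi : 1 ≤ i) :
    -(1 / (b : ℂ)) * seriesS lam b q z y k i =
      (serviceOp (1 / (lam q * b)) (xParam lam b q z))^[k] (fun a => z q ^ a) i := by
  obtain ⟨n, rfl⟩ : ∃ n, k = n + 2 := ⟨k - 2, by omega⟩
  obtain ⟨hy1, hw⟩ := (isUnitDiscRoot_iff hlam hb y).1 hy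
  have hx := one_lt_norm_xParam (q := q) hlam hb hz
  have hx0 : xParam lam b q z ≠ 0 := norm_pos_iff.1 (by linarith)
  have hxz := sub_ne_zero_of_norm_lt hx (hz q)
  have hl : (lam q : ℂ) ≠ 0 := by exact_mod_cast (hlam q).ne'
  have hb0 : (b : ℂ) ≠ 0 := by exact_mod_cast hb.ne'
  rw [iterate_serviceOp_pow hx hy1 (hz q) hw n hi, seriesS]
  have e1 : xParam lam b q z ^ (-2 * ((n + 2 : ℕ) : ℤ) + i) =
      xParam lam b q z ^ i / xParam lam b q z ^ (2 * (n + 2)) := by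
    rw [show -2 * ((n + 2 : ℕ) : ℤ) + i = (i : ℤ) - ((2 * (n + 2) : ℕ) : ℤ) by push_cast; ring,
      zpow_sub₀ hx0, zpow_natCast, zpow_natCast]
  have e2 : (1 / ((lam q : ℂ) * b)) ^ (n + 2) = 1 / ((lam q : ℂ) * b) ^ (n + 2) := by
    rw [div_pow, one_pow]
  rw [zpow_add_one₀ hx0, e1, e2, show n + 2 - 1 = n + 1 from rfl]
  generalize ∑' j : ℕ, (latticeCount (n + 1) i (j + 1) : ℂ) * (z q / xParam lam b q z) ^ j = T₁
  generalize ∑' j : ℕ, (latticeCount (n + 2) i (j + 1) : ℂ) *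
    (y / xParam lam b q z) ^ (j + 1) = T₂
  generalize xParam lam b q z ^ i / xParam lam b q z ^ (2 * (n + 2)) = X
  field_simp
  ring

lemma one_div_add_mul_one_sub_add_otherRate (hlam : ∀ m, 0 < lam m) :
    1 / (b : ℂ) + (lam q : ℂ) * (1 - z q) + otherRate lam q z =
      lam q * (xParam lam b q z - z q) := by
  linear_combination -lam_mul_xParam (b := b) (q := q) (z := z) hlam

lemma monom_update_zero (n : Fin M → ℕ) :
    monom (Function.update z q 0) n =
      (∏ m ∈ Finset.univ.erase q, z m ^ n m) * 0 ^ n q := by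
  rw [monom_eq_prod_erase_mul _ q, Function.update_self]
  congr 1
  exact Finset.prod_congr rfl fun m hm => by
    rw [Function.update_of_ne (Finset.ne_of_mem_erase hm)]

end Formulas

end Polling

open Polling
theorem mainTheorem3 {Ω : Type*} [MeasurableSpace Ω] (P : Measure Ω) [IsProbabilityMeasure P]
    {M : ℕ} (lam : Fin M → ℝ) (hlam : ∀ m, 0 < lam m) (b : ℝ) (hb : 0 < b)
    (Nb : Ω → Fin M → ℕ) (A : Fin M → ℝ≥0 → Ω → ℕ) (S : ℕ → Ω → ℝ≥0)
    (hmodel : IsVisitModel P lam b Nb A S) (q : Fin M)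
    (z : Fin M → ℂ) (hz : ∀ m, ‖z m‖ ≤ 1) :
    -- the expectations below are those of integrable random variables
    (∀ k, 1 ≤ k → Integrable (fun ω => monom z (endState Nb A S q k ω)) P) ∧
    -- arbitrary `k ≥ 2`: the conditional p.g.f. through the series `S`
    (∃ y, IsUnitDiscRoot lam b q z y) ∧
    (lam q * b < 1 → ∃! y, IsUnitDiscRoot lam b q z y) ∧
    (∀ y, IsUnitDiscRoot lam b q z y → ∀ k, 2 ≤ k → ∀ i : Fin M → ℕ, 1 ≤ i q →
      P (Nb ⁻¹' {i}) ≠ 0 →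
      Summable (fun j : ℕ =>
        (latticeCount (k - 1) (i q) (j + 1) : ℂ) * (z q / xParam lam b q z) ^ j) ∧
      Summable (fun j : ℕ =>
        (latticeCount k (i q) (j + 1) : ℂ) * (y / xParam lam b q z) ^ (j + 1)) ∧
      condPgf P (endState Nb A S q k) Nb i z =
        -(1 / (b : ℂ)) * (∏ m ∈ Finset.univ.erase q, z m ^ i m)
          * seriesS lam b q z y k (i q)) ∧
    -- `k = 1`: conditional p.g.f.
    (∀ i : Fin M → ℕ, i q = 1 → P (Nb ⁻¹' {i}) ≠ 0 →
      condPgf P (endState Nb A S q 1) Nb i z =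
        (∏ m ∈ Finset.univ.erase q, z m ^ i m) / ((lam q : ℂ) * b * xParam lam b q z)
          * (z q / (xParam lam b q z - z q) + 1)) ∧
    (∀ i : Fin M → ℕ, 2 ≤ i q → P (Nb ⁻¹' {i}) ≠ 0 →
      condPgf P (endState Nb A S q 1) Nb i z =
        (∏ m ∈ Finset.univ.erase q, z m ^ i m)
          * (z q ^ (i q - 1) / ((lam q : ℂ) * b * (xParam lam b q z - z q)))) ∧
    -- `k = 1`: p.g.f.
    (z q ≠ 0 →
      pgf P (endState Nb A S q 1) z =
        (1 / (b : ℂ) * (z q)⁻¹)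
            / (1 / (b : ℂ) + (lam q : ℂ) * (1 - z q) + otherRate lam q z) * pgf P Nb z
          + (1 - (1 / (b : ℂ) * (z q)⁻¹)
            / (1 / (b : ℂ) + (lam q : ℂ) * (1 - z q) + otherRate lam q z))
            * pgf P Nb (Function.update z q 0)) ∧
    -- `k = 2`: conditional p.g.f.
    (∀ i : Fin M → ℕ, i q = 1 → P (Nb ⁻¹' {i}) ≠ 0 →
      condPgf P (endState Nb A S q 2) Nb i z =
        (∏ m ∈ Finset.univ.erase q, z m ^ i m) / ((lam q : ℂ) * b * xParam lam b q z)
          * (1 / ((lam q : ℂ) * b * (xParam lam b q z - z q) ^ 2) + 1)) ∧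
    (∀ i : Fin M → ℕ, 2 ≤ i q → P (Nb ⁻¹' {i}) ≠ 0 →
      condPgf P (endState Nb A S q 2) Nb i z =
        (∏ m ∈ Finset.univ.erase q, z m ^ i m)
          * (z q ^ (i q - 2) / ((lam q : ℂ) ^ 2 * (b : ℂ) ^ 2 * (xParam lam b q z - z q) ^ 2))) ∧
    -- `k = 2`: p.g.f.
    (z q ≠ 0 →
      pgf P (endState Nb A S q 2) z =
        (z q ^ 2)⁻¹ / ((lam q : ℂ) ^ 2 * (b : ℂ) ^ 2 * (xParam lam b q z - z q) ^ 2)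
            * pgf P Nb z
          + (1 - (z q ^ 2)⁻¹ / ((lam q : ℂ) ^ 2 * (b : ℂ) ^ 2 * (xParam lam b q z - z q) ^ 2))
            * pgf P Nb (Function.update z q 0)
          + ((z q)⁻¹ / ((lam q : ℂ) * b * xParam lam b q z)
              - (z q ^ 2)⁻¹ / ((lam q : ℂ) ^ 2 * (b : ℂ) ^ 2 * xParam lam b q z
                  * (xParam lam b q z - z q)))
            * ∫ ω, ({ω | Nb ω q = 1} : Set Ω).indicator (fun ω => monom z (Nb ω)) ω ∂P) := by
  have hx := one_lt_norm_xParam (q := q) hlam hb hz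
  have hx0 : xParam lam b q z ≠ 0 := norm_pos_iff.1 (by linarith)
  have hxz := sub_ne_zero_of_norm_lt hx (hz q)
  have hl : (lam q : ℂ) ≠ 0 := by exact_mod_cast (hlam q).ne'
  have hb0 : (b : ℂ) ≠ 0 := by exact_mod_cast hb.ne'
  have hmonom {z' : Fin M → ℂ} (hz' : ∀ m, ‖z' m‖ ≤ 1) {N : Ω → Fin M → ℕ} (hN : Measurable N) :
      Integrable (fun ω => monom z' (N ω)) P :=
    integrable_comp_of_bound hN (norm_prod_pow_le_one hz' _)
  have hz0 : ∀ m, ‖Function.update z q 0 m‖ ≤ 1 := by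
    intro m
    rcases eq_or_ne m q with rfl | hm
    · simp
    · rw [Function.update_of_ne hm]; exact hz m
  have hI := hmonom hz hmodel.measurable_begin
  have hI0 := hmonom hz0 hmodel.measurable_begin
  refine ⟨fun k _ => hmonom hz (measurable_endState hmodel q k),
    exists_isUnitDiscRoot hlam hb hz, existsUnique_isUnitDiscRoot hlam hb hz, ?_, ?_, ?_, ?_, ?_,
    ?_, ?_⟩
  · intro y hy k hk i hi hPi
    refine ⟨summable_latticeCount_mul_cpow _ _ (norm_div_lt_one hx (hz q)),
      summable_latticeCount_mul_cpow_succ _ _ (norm_div_lt_one hx hy.1), ?_⟩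
    rw [condPgf_endState hmodel hlam hb q hz k hPi, ← seriesS_eq hlam hb hz hy hk hi]
    ring
  · intro i hi hPi
    rw [condPgf_endState hmodel hlam hb q hz 1 hPi, Function.iterate_one,
      serviceOp_pow hx (hz q) (by omega), hi]
    field_simp
    ring
  · intro i hi hPi
    rw [condPgf_endState hmodel hlam hb q hz 1 hPi, Function.iterate_one,
      serviceOp_pow hx (hz q) (by omega)]
    field_simp
  · intro hzq
    rw [pgf_endState hmodel hlam hb q hz 1, one_div_add_mul_one_sub_add_otherRate hlam]
    set c : ℂ := 1 / (b : ℂ) * (z q)⁻¹ / (lam q * (xParam lam b q z - z q)) with hc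
    rw [pgf, pgf, ← integral_const_mul, ← integral_const_mul,
      ← integral_add (hI.const_mul _) (hI0.const_mul _)]
    refine integral_congr_ae (Filter.Eventually.of_forall fun ω => ?_)
    simp only [Function.iterate_one]
    rw [monom_eq_prod_erase_mul z q, monom_update_zero]
    generalize (∏ m ∈ Finset.univ.erase q, z m ^ Nb ω m) = p
    rcases hn : Nb ω q with _ | n
    · simp only [serviceOp, if_true, pow_zero]; ring
    · rw [serviceOp_pow hx (hz q) (by omega), hc]
      simp only [Nat.add_sub_cancel]
      rw [zero_pow (by omega), pow_succ]
      field_simp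
      ring
  · intro i hi hPi
    rw [condPgf_endState hmodel hlam hb q hz 2 hPi, hi]
    simp only [Function.iterate_succ, Function.iterate_zero, Function.comp_apply, id]
    rw [serviceOp_serviceOp_pow_one hx (hz q)]
    field_simp
  · intro i hi hPi
    rw [condPgf_endState hmodel hlam hb q hz 2 hPi]
    simp only [Function.iterate_succ, Function.iterate_zero, Function.comp_apply, id]
    rw [serviceOp_serviceOp_pow hx (hz q) hi]
    field_simp
  · intro hzq
    rw [pgf_endState hmodel hlam hb q hz 2]
    set c : ℂ := (z q ^ 2)⁻¹ / ((lam q : ℂ) ^ 2 * (b : ℂ) ^ 2 * (xParam lam b q z - z q) ^ 2)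
      with hc
    set d : ℂ := (z q)⁻¹ / ((lam q : ℂ) * b * xParam lam b q z)
      - (z q ^ 2)⁻¹ / ((lam q : ℂ) ^ 2 * (b : ℂ) ^ 2 * xParam lam b q z
        * (xParam lam b q z - z q)) with hd
    have hm1 : MeasurableSet {ω | Nb ω q = 1} :=
      (measurable_pi_apply q).comp hmodel.measurable_begin (measurableSet_singleton 1)
    rw [pgf, pgf, ← integral_const_mul, ← integral_const_mul, ← integral_const_mul,
      ← integral_add (hI.const_mul _) (hI0.const_mul _),
      ← integral_add (f := fun ω => c * monom z (Nb ω) +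
          (1 - c) * monom (Function.update z q 0) (Nb ω))
        ((hI.const_mul _).add (hI0.const_mul _)) ((hI.indicator hm1).const_mul _)]
    refine integral_congr_ae (Filter.Eventually.of_forall fun ω => ?_)
    have hind : ({ω | Nb ω q = 1} : Set Ω).indicator (fun ω => monom z (Nb ω)) ω =
        if Nb ω q = 1 then monom z (Nb ω) else 0 := by
      by_cases h : Nb ω q = 1 <;> simp [h]
    simp only [Function.iterate_succ, Function.iterate_zero, Function.comp_apply, id]
    rw [hind, monom_eq_prod_erase_mul z q, monom_update_zero]
    generalize (∏ m ∈ Finset.univ.erase q, z m ^ Nb ω m) = p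
    rcases hn : Nb ω q with _ | _ | n
    · simp only [serviceOp, if_true, pow_zero]
      norm_num
      ring
    · rw [serviceOp_serviceOp_pow_one hx (hz q), hc, hd]
      simp only [zero_add, pow_one, if_true, mul_zero, add_zero]
      field_simp
      ring
    · rw [serviceOp_serviceOp_pow hx (hz q) (by omega), hc]
      rw [if_neg (by omega), zero_pow (by omega), show n + 1 + 1 - 2 = n by omega,
        show n + 1 + 1 = n + 2 from rfl, pow_add]
      field_simp
      ring
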